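/- Theorem (Coercivity). Let $d\ge 2$ and $p_{\max}\ge 1$. There is a constant $C>0$, depending only on $d$ and $p_{\max}$, such that the following holds. Let $\mathcal T_h$ be a finite mesh in $\mathbb R^d$ whose elements $K$ are closed nondegenerate simplices or parallelotopes (for $d=2$: triangles or affine quadrilaterals) with pairwise disjoint interiors. Let $\Gamma_i$ be the set of interior intersections, that is, of the sets $e=K_e^-\cap K_e^+$, for two distinct elements $K_e^\pm$, that have positive $(d-1)$-dimensional measure. Let $\mathbf n$ be the unit normal of $e$ pointing from $K_e^-$ to $K_e^+$ and put $$h_e=\frac{2|K_e^-||K_e^+|}{|e|(|K_e^-|+|K_e^+|)} .$$ The mesh is matching (each $e\in\Gamma_i$ is a common facet of $K_e^-$ and $K_e^+$) or, more generally, may have hanging nodes, in the sense that for each $e\in\Gamma_i$ and each $K\in\{K_e^-,K_e^+\}$, $e$ is contained in a facet $F$ of $K$, with $e=F$ or $|F|\,h_e\le 2|K|$. Let each element carry a polynomial degree $1\le p_K\le p_{\max}$, and let $V_h^p$ be the space of functions whose restriction to each $K$ is a polynomial of total degree at most $p_K$. For $e\in\Gamma_i$ write $\varphi^\pm$ for the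 traces from $K_e^\pm$, and $[\![\varphi]\!]=\varphi^--\varphi^+$, $\{\varphi\}=\frac12(\varphi^-+\varphi^+)$, $\{\!\{\varphi\}\!\}=\frac{2\varphi^-\varphi^+}{\varphi^-+\varphi^+}$. Let $\phi_h\in V_h^p$ be a fixed phase-field and let $M:\mathbb R\to\mathbb R$ be a continuous mobility (for instance $M(s)=\max\{1-s^2,0\}$, or $\max\{M,\delta\}$ for this $M$) such that $M(\phi_h)\ge\delta$ on every element, for some $\delta>0$. For penalty parameters $\eta_e$ and integrable mobility fluxes $\Lambda_e:e\to\mathbb R$, let $$b(M(\phi_h),\upsilon,\varphi)=\sum_{K}\int_K M(\phi_h)\nabla\upsilon\cdot\nabla\varphi\,dx+\sum_{e\in\Gamma_i}\int_e \frac{\eta_e\Lambda_e}{h_e}[\![\upsilon]\!][\![\varphi]\!]-F(M(\phi_h),\upsilon)\cdot\mathbf n\,[\![\varphi]\!]-F(M(\phi_h),\varphi)\cdot\mathbf n\,[\![\upsilon]\!]\,ds,$$ $$\|\upsilon\|_{DG}^2=\sum_K\big\|\sqrt{M(\phi_h)}\,\nabla\upsilon\big\|_{L^2(K)}^2+\sum_{e\in\Gamma_i}\int_e\frac{\Lambda_e\eta_e}{h_e}[\![\upsilon]\!]^2\,ds,$$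 where either - (SWIP) $F(M(\phi_h),\upsilon)=\{\!\{M(\phi_h)\}\!\}\{\nabla\upsilon\}$ and $\tilde M_e=\{\!\{M(\phi_h)\}\!\}$, or - (SIPG) $F(M(\phi_h),\upsilon)=\{M(\phi_h)\nabla\upsilon\}$ and $\tilde M_e=\max\{M(\phi_h^+),M(\phi_h^-)\}$. Let $\alpha\in[0,\frac12]$ and $$\lambda^\star=\max_{K\in\mathcal T_h}\ \sum_{e\in\Gamma_i,\ e\subset\partial K}\frac{\|\tilde M_e\|_{L^\infty(e)}^{2-2\alpha}}{\min_{x\in K}M(\phi_h(x))} .$$ If for every $e\in\Gamma_i$ $$\eta_e\ \ge\max_{p\in\{p_{K_e^-},\,p_{K_e^+}\}}p(p+d-1)\qquad\text{and}\qquad \Lambda_e\ \ge\ \tilde M_e^{2\alpha}\,\lambda^\star\ \text{ on } e,$$ then for all $\upsilon_h\in V_h^p$ $$\|\upsilon_h\|_{DG}^2\ \le\ C\,b(M(\phi_h),\upsilon_h,\upsilon_h).$$ -/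

import Mathlib

open MeasureTheory
open scoped MeasureTheory

noncomputable section

namespace DGMobility

/-- Euclidean space of dimension `d`. -/
abbrev E (d : ℕ) : Type := EuclideanSpace ℝ (Fin d)

/-! ### Elements and meshes -/

/-- A mesh element: a nondegenerate simplex (triangle, tetrahedron, …) or a nondegenerate
parallelotope (affine quadrilateral, affine hexahedron, …). -/
inductive Cell (d : ℕ) : Type where
  /-- The simplex with the given vertices. -/
  | simplex (v : Fin (d + 1) → E d) (hv : AffineIndependent ℝ v)
  /-- The parallelotope with corner `x₀` and edge vectors `a i`. -/
  | parallelotope (x₀ : E d) (a : Fin d → E d) (ha : LinearIndependent ℝ a)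

namespace Cell

variable {d : ℕ}

/-- The closed set occupied by an element. -/
def carrier : Cell d → Set (E d)
  | simplex v _ => convexHull ℝ (Set.range v)
  | parallelotope x₀ a _ =>
      {x | ∃ t : Fin d → ℝ, (∀ i, t i ∈ Set.Icc (0 : ℝ) 1) ∧ x = x₀ + ∑ i, t i • a i}

/-- The facets, that is, the closed `(d-1)`-dimensional faces of an element. -/
def facets : Cell d → Set (Set (E d))
  | simplex v _ => {F | ∃ i, F = convexHull ℝ (v '' {i}ᶜ)}
  | parallelotope x₀ a _ =>
      {F | ∃ i : Fin d, ∃ s : ℝ, (s = 0 ∨ s = 1) ∧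
        F = {x | ∃ t : Fin d → ℝ, (∀ j, t j ∈ Set.Icc (0 : ℝ) 1) ∧ t i = s ∧
          x = x₀ + ∑ j, t j • a j}}

/-- The `d`-dimensional volume `|K|`. -/
def vol (K : Cell d) : ℝ := (volume : Measure (E d)).real K.carrier

end Cell

/-- The surface measure: `(d-1)`-dimensional Hausdorff measure, normalised so that it is Lebesgue
measure on hyperplanes. -/
abbrev surf (d : ℕ) : Measure (E d) := μHE[d - 1]

/-- The length scale `h_e = 2|K⁻||K⁺| / (|e| (|K⁻| + |K⁺|))` of the intersection `e = K⁻ ∩ K⁺`. -/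
def lengthScale {d : ℕ} (K L : Cell d) : ℝ :=
  2 * K.vol * L.vol / ((surf d).real (K.carrier ∩ L.carrier) * (K.vol + L.vol))

/-- A mesh with `N` elements. Two elements do not overlap. Whenever two elements meet in a set `e`
of positive surface measure, `e` lies in a facet `F` of either of them; it is either the whole facet
(matching case) or a part of it (hanging nodes), and then `|F| h_e ≤ 2 |K|`. This size bound
holds by itself if `e = F`, and it holds for hanging nodes that come from regular refinement. -/
structure Mesh (d N : ℕ) where
  /-- The elements. -/
  cell : Fin N → Cell d
  disjoint_interior : ∀ i j, i ≠ j →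
    Disjoint (interior (cell i).carrier) (interior (cell j).carrier)
  facet_of_intersection : ∀ i j, i ≠ j → 0 < surf d ((cell i).carrier ∩ (cell j).carrier) →
    ∃ F ∈ (cell i).facets, (cell i).carrier ∩ (cell j).carrier ⊆ F ∧
      (F = (cell i).carrier ∩ (cell j).carrier ∨
        (surf d).real F * lengthScale (cell i) (cell j) ≤ 2 * (cell i).vol)
  /-- `normal i j` is the unit normal of the intersection of elements `i < j`. -/
  normal : Fin N → Fin N → E d
  /-- The normal is a unit vector that points from element `i` to element `j`; this determines it
  uniquely. -/
  normal_spec : ∀ i j, i < j → 0 < surf d ((cell i).carrier ∩ (cell j).carrier) →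
    ‖normal i j‖ = 1 ∧
      ∀ x ∈ (cell i).carrier, ∀ y ∈ (cell j).carrier, 0 ≤ inner ℝ (normal i j) (y - x)

namespace Mesh

variable {d N : ℕ} (𝒯 : Mesh d N)

/-- The closed set occupied by element number `i`. -/
def elem (i : Fin N) : Set (E d) := (𝒯.cell i).carrier

/-- The intersection `e` with `K⁻ = K_i`, `K⁺ = K_j` for `e = (i, j)`. -/
def face (e : Fin N × Fin N) : Set (E d) := 𝒯.elem e.1 ∩ 𝒯.elem e.2

open scoped Classical in
/-- The set `Γ_i` of interior intersections, each listed once, as a pair `(K⁻, K⁺)` ordered by the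
numbering of the elements. -/
def faces : Finset (Fin N × Fin N) :=
  Finset.univ.filter fun e => e.1 < e.2 ∧ 0 < surf d (𝒯.face e)

/-- The length scale `h_e`. -/
def h (e : Fin N × Fin N) : ℝ := lengthScale (𝒯.cell e.1) (𝒯.cell e.2)

end Mesh

/-! ### Broken polynomials -/

/-- Piecewise polynomials on `N` elements, given by one polynomial per element. -/
abbrev Broken (d N : ℕ) : Type := Fin N → MvPolynomial (Fin d) ℝ

namespace Broken

variable {d N : ℕ}

/-- The space `V_h^p`, with local polynomial degrees `p i`. -/
def space (p : Fin N → ℕ) : Set (Broken d N) := {φ | ∀ i, (φ i).totalDegree ≤ p i}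

/-- The value at `x` of the polynomial on element `i`. -/
def val (φ : Broken d N) (i : Fin N) (x : E d) : ℝ := MvPolynomial.eval x.ofLp (φ i)

/-- The gradient at `x` of the polynomial on element `i`. -/
def grad (φ : Broken d N) (i : Fin N) (x : E d) : E d :=
  WithLp.toLp 2 fun k => MvPolynomial.eval x.ofLp (MvPolynomial.pderiv k (φ i))

/-- The jump `φ⁻ - φ⁺` on the intersection `e`. -/
def jump (φ : Broken d N) (e : Fin N × Fin N) (x : E d) : ℝ := φ.val e.1 x - φ.val e.2 x

end Broken

/-! ### Mobility fluxes -/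

/-- The two choices of the mobility flux. -/
inductive Scheme : Type where
  | swip
  | sipg

/-- Harmonic average. -/
def haver (a b : ℝ) : ℝ := 2 * a * b / (a + b)

/-- The mobility flux `F` from the one-sided mobilities `a, b` and one-sided gradients `G, H`:
`{{a, b}} (G + H) / 2` with the harmonic average for SWIP, and `(a G + b H) / 2` for SIPG. -/
def Scheme.flux {d : ℕ} (s : Scheme) (a b : ℝ) (G H : E d) : E d :=
  match s with
  | .swip => haver a b • ((1 / 2 : ℝ) • (G + H))
  | .sipg => (1 / 2 : ℝ) • (a • G + b • H)

/-- The face mobility `M̃_e` from the one-sided mobilities: the harmonic average for SWIP, the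
maximum for SIPG. -/
def Scheme.faceMobility (s : Scheme) (a b : ℝ) : ℝ :=
  match s with
  | .swip => haver a b
  | .sipg => max a b

section forms

variable {d N : ℕ} (𝒯 : Mesh d N) (s : Scheme)

/-- The form `b(m, υ, w)` with penalty parameters `η`, penalty mobility fluxes `Λ`, and mobility `m`
(given elementwise). Jumps vanish on boundary intersections (there `K⁻ = K⁺`), so only interior
intersections contribute. -/
def form (η : Fin N × Fin N → ℝ) (Λ : Fin N × Fin N → E d → ℝ) (m : Fin N → E d → ℝ)
    (υ w : Broken d N) : ℝ :=
  (∑ i, ∫ x in 𝒯.elem i, m i x * inner ℝ (υ.grad i x) (w.grad i x)) +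
  ∑ e ∈ 𝒯.faces, ∫ x in 𝒯.face e,
    (η e * Λ e x / 𝒯.h e * υ.jump e x * w.jump e x
      - inner ℝ (s.flux (m e.1 x) (m e.2 x) (υ.grad e.1 x) (υ.grad e.2 x)) (𝒯.normal e.1 e.2)
          * w.jump e x
      - inner ℝ (s.flux (m e.1 x) (m e.2 x) (w.grad e.1 x) (w.grad e.2 x)) (𝒯.normal e.1 e.2)
          * υ.jump e x) ∂(surf d)

/-- The square of the mobility-weighted DG seminorm. -/
def seminormSq (η : Fin N × Fin N → ℝ) (Λ : Fin N × Fin N → E d → ℝ) (m : Fin N → E d → ℝ)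
    (υ : Broken d N) : ℝ :=
  (∑ i, ∫ x in 𝒯.elem i, ‖√(m i x) • υ.grad i x‖ ^ 2) +
  ∑ e ∈ 𝒯.faces, ∫ x in 𝒯.face e, Λ e x * η e / 𝒯.h e * υ.jump e x ^ 2 ∂(surf d)

/-- The face mobility `M̃_e` as a function on the intersection `e`. -/
def faceMob (m : Fin N → E d → ℝ) (e : Fin N × Fin N) (x : E d) : ℝ :=
  s.faceMobility (m e.1 x) (m e.2 x)

open scoped Classical in
/-- The maximum contrast
`λ* = max_K ∑_{e ⊆ ∂K} ‖M̃_e‖_{L^∞(e)}^{2 - 2α} / min_K m`, where `e` runs over the interior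
intersections of `K`. (For continuous positive `m` the `L^∞` norm is the supremum.) -/
def contrast (α : ℝ) (m : Fin N → E d → ℝ) : ℝ :=
  ⨆ i : Fin N, ∑ e ∈ 𝒯.faces.filter (fun e => e.1 = i ∨ e.2 = i),
    sSup (faceMob s m e '' 𝒯.face e) ^ (2 - 2 * α) / sInf (m i '' 𝒯.elem i)

end forms

end DGMobility

end

namespace DGMobility

/-! With υ in both slots, b is the gradient energy plus the penalty minus twice the consistency term
(F · n)[[υ]], so coercivity means absorbing that term with something to spare. On a face, both
fluxes satisfy 2|F · n| ≤ M̃ (|∂ₙυ⁻| + |∂ₙυ⁺|) (`Scheme.two_mul_abs_inner_flux_le`). Split M̃² =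
M̃^(2-2α) M̃^(2α): the second factor is at most Λ/λ*, the first at most its supremum S_e. Young's
inequality (`consistency_le_of_sq_le`) then leaves a fraction of the penalty and normal derivatives
weighted by S_e h_e/(η λ*). A trace inequality moves these into the two neighbouring elements, and
summing S_e over the faces of an element costs λ* times the minimal mobility
(`sum_faces_le_contrast_mul`), so λ* cancels and the weighted energy appears.

The trace inequality |K| ∫_F g² ≤ (n+1)² |F| ∫_K g² has no shape constant. A simplex is a cone and a
parallelotope a prism over any of its facets, so Fubini along rays reduces it to a bound for q(1)²
with weight s^m on [0, 1] (`sq_eval_one_le`). The representer of q ↦ q(1) is found by solving a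
Cauchy system explicitly.

The constants just fit. Normal derivatives have degree p - 1 and h_e |F| ≤ 2|K|, which yields 2p².
As d ≥ 2, p(p+d-1) exceeds p² by a factor of at least (P+1)/P, where P is the maximal degree
(`natCast_sq_mul_le`). This gap is the whole margin and produces C = 2(P+1). -/

/-! ### Endpoint evaluation of polynomials in one variable -/

open Polynomial in
/-- The coefficients of the polynomial that represents evaluation at `1` on polynomials of degree
at most `n` with respect to the weight `s ^ m` on `[0, 1]`. -/
theorem exists_cauchy_coefficients (n m : ℕ) :
    ∃ a : ℕ → ℝ, (∀ j ∈ Finset.range (n + 1),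
        ∑ i ∈ Finset.range (n + 1), a i / ((j : ℝ) + i + m + 1) = 1) ∧
      ∑ i ∈ Finset.range (n + 1), a i = (n + 1) * (n + 1 + m) := by
  classical
  set s := Finset.range (n + 1) with hs
  have hcard : s.card = n + 1 := Finset.card_range _
  let v : ℕ → ℝ := fun i => -((i : ℝ) + m + 1)
  have hv : Set.InjOn v s := fun i _ j _ h => by
    have h' : (i : ℝ) = j := by simp only [v] at h; linarith
    exact_mod_cast h'
  let w : ℕ → ℝ := fun j => (j : ℝ)
  -- The `a i` are the partial fraction coefficients of P / nodal v = 1 - nodal w / nodal v, which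
  -- equals 1 at every node j of w. Both nodal polynomials are monic, so the fraction is proper, and
  -- the sum of the `a i` is the coefficient of X^n in P, namely the difference of the node sums.
  let P : ℝ[X] := Lagrange.nodal s v - Lagrange.nodal s w
  have hdeg : P.degree < s.card := by
    have h1 : (Lagrange.nodal s v).degree = s.card := Lagrange.degree_nodal
    have h2 : (Lagrange.nodal s w).degree = s.card := Lagrange.degree_nodal
    rw [← h1]
    refine Polynomial.degree_sub_lt_left (h1.trans h2.symm) Lagrange.nodal_ne_zero ?_
    rw [Lagrange.nodal_monic.leadingCoeff, Lagrange.nodal_monic.leadingCoeff]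
  have hcoeff : P.coeff (s.card - 1) = (n + 1) * (n + 1 + m) := by
    have h0 : 0 < s.card := by omega
    have hg : ∑ i ∈ s, (i : ℝ) = n * (n + 1) / 2 := by
      have := Finset.sum_range_id_mul_two (n + 1)
      have h2 : ((∑ i ∈ Finset.range (n + 1), i : ℕ) : ℝ) * 2 = (n + 1) * n := by
        exact_mod_cast this
      push_cast at h2
      linarith
    simp only [P, Lagrange.nodal_eq, coeff_sub]
    rw [prod_X_sub_C_coeff_card_pred s v h0, prod_X_sub_C_coeff_card_pred s w h0]
    simp only [v, w, Finset.sum_neg_distrib, Finset.sum_add_distrib, hg, Finset.sum_const, hcard,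
      nsmul_eq_mul]
    push_cast
    ring
  refine ⟨fun i => P.eval (v i) / ∏ j ∈ s.erase i, (v i - v j), fun j hj => ?_, ?_⟩
  · have hx : ∀ i ∈ s, w j ≠ v i := fun i _ h => by
      have : (0 : ℝ) < (j : ℝ) + i + m + 1 := by positivity
      simp only [v, w] at h
      linarith
    have hA : (Lagrange.nodal s v).eval (w j) ≠ 0 := by
      rw [Lagrange.eval_nodal]
      exact Finset.prod_ne_zero_iff.mpr fun i hi => sub_ne_zero.mpr (hx i hi)
    have h1 : P.eval (w j) = (Lagrange.nodal s v).eval (w j) := by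
      simp [P, Lagrange.eval_nodal_at_node hj]
    have h2 : P.eval (w j) = (Lagrange.nodal s v).eval (w j) *
        ∑ i ∈ s, Lagrange.nodalWeight s v i * (w j - v i)⁻¹ * P.eval (v i) := by
      conv_lhs => rw [Lagrange.eq_interpolate hv hdeg]
      exact Lagrange.eval_interpolate_not_at_node _ hx
    have h3 : ∑ i ∈ s, Lagrange.nodalWeight s v i * (w j - v i)⁻¹ * P.eval (v i) = 1 :=
      mul_left_cancel₀ hA (by rw [← h2, h1, mul_one])
    refine Eq.trans ?_ h3
    refine Finset.sum_congr rfl fun i hi => ?_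
    have : w j - v i = (j : ℝ) + i + m + 1 := by simp only [v, w]; ring
    rw [this, Lagrange.nodalWeight, Finset.prod_inv_distrib]
    ring
  · rw [← Lagrange.coeff_eq_sum hv hdeg, hcoeff]

/-- The sharp endpoint estimate for polynomials of degree at most `n` on `[0, 1]` with respect to
the weight `s ^ m`. -/
theorem sq_eval_one_le (n m : ℕ) (q : Polynomial ℝ) (hq : q.natDegree ≤ n) :
    q.eval 1 ^ 2 ≤ (n + 1) * (n + 1 + m) * ∫ s in (0 : ℝ)..1, s ^ m * q.eval s ^ 2 := by
  obtain ⟨a, ha, hsum⟩ := exists_cauchy_coefficients n m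
  let r : Polynomial ℝ :=
    ∑ i ∈ Finset.range (n + 1), Polynomial.C (a i) * Polynomial.X ^ i
  have hr : r.natDegree ≤ n := Polynomial.natDegree_sum_le_of_forall_le _ _ fun i hi =>
    (Polynomial.natDegree_C_mul_X_pow_le _ _).trans (by simpa [Nat.lt_succ_iff] using hi)
  have hr_eval : ∀ s, r.eval s = ∑ i ∈ Finset.range (n + 1), a i * s ^ i := fun s => by
    simp [r, Polynomial.eval_finsetSum]
  -- The Cauchy system says that r has weighted inner product 1 with each monomial, so r represents
  -- evaluation at 1.
  have hrep : ∀ f : Polynomial ℝ, f.natDegree ≤ n →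
      ∫ s in (0 : ℝ)..1, s ^ m * (f.eval s * r.eval s) = f.eval 1 := by
    intro f hf
    have h1 : ∀ s : ℝ, s ^ m * (f.eval s * r.eval s) = ∑ j ∈ Finset.range (n + 1),
        ∑ i ∈ Finset.range (n + 1), (f.coeff j * a i) * s ^ (j + i + m) := fun s => by
      rw [Polynomial.eval_eq_sum_range' (Nat.lt_succ_of_le hf), hr_eval, Finset.sum_mul_sum,
        Finset.mul_sum]
      refine Finset.sum_congr rfl fun j _ => ?_
      rw [Finset.mul_sum]
      refine Finset.sum_congr rfl fun i _ => ?_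
      ring
    simp_rw [h1]
    rw [intervalIntegral.integral_finsetSum
      (fun j _ => (by fun_prop : Continuous _).intervalIntegrable _ _)]
    rw [Polynomial.eval_eq_sum_range' (Nat.lt_succ_of_le hf)]
    refine Finset.sum_congr rfl fun j hj => ?_
    rw [intervalIntegral.integral_finsetSum
      (fun j _ => (by fun_prop : Continuous _).intervalIntegrable _ _)]
    simp only [intervalIntegral.integral_const_mul, integral_pow]
    have := ha j hj
    rw [one_pow]
    conv_rhs => rw [← this, Finset.mul_sum]
    refine Finset.sum_congr rfl fun i _ => ?_
    rw [one_pow, zero_pow (by omega)]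
    push_cast
    ring
  set R : ℝ := (n + 1) * (n + 1 + m) with hR
  have hRpos : 0 < R := by positivity
  have hr1 : r.eval 1 = R := by rw [hr_eval]; simpa using hsum
  -- Cauchy–Schwarz for q and r, by expanding one square. The representation property gives ‖r‖² =
  -- r(1) = R.
  have hnn : 0 ≤ ∫ s in (0 : ℝ)..1, s ^ m * (R * q.eval s - q.eval 1 * r.eval s) ^ 2 :=
    intervalIntegral.integral_nonneg zero_le_one fun s hs =>
      mul_nonneg (pow_nonneg hs.1 _) (sq_nonneg _)
  have hexp : ∫ s in (0 : ℝ)..1, s ^ m * (R * q.eval s - q.eval 1 * r.eval s) ^ 2 =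
      R ^ 2 * (∫ s in (0 : ℝ)..1, s ^ m * q.eval s ^ 2)
      - 2 * R * q.eval 1 * (∫ s in (0 : ℝ)..1, s ^ m * (q.eval s * r.eval s))
      + q.eval 1 ^ 2 * (∫ s in (0 : ℝ)..1, s ^ m * (r.eval s * r.eval s)) := by
    rw [← intervalIntegral.integral_const_mul, ← intervalIntegral.integral_const_mul,
      ← intervalIntegral.integral_const_mul, ← intervalIntegral.integral_sub,
      ← intervalIntegral.integral_add]
    · congr 1
      ext s
      ring
    all_goals exact (by fun_prop : Continuous _).intervalIntegrable _ _
  rw [hexp, hrep q hq, hrep r hr, hr1] at hnn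
  have : 0 ≤ R * (R * (∫ s in (0 : ℝ)..1, s ^ m * q.eval s ^ 2) - q.eval 1 ^ 2) := by linarith
  have := nonneg_of_mul_nonneg_right this hRpos
  linarith

/-! ### Integration over cones, prisms and their affine images -/

open scoped Pointwise in
/-- Fubini's theorem on a cone (`b = 1`) or a prism (`b = 0`) over `S`. -/
theorem setIntegral_image_cone {k : ℕ} (b : ℕ) {S : Set (E k)} (hS : IsCompact S)
    {f : ℝ × E k → ℝ} (hf : Continuous f) :
    ∫ p in (fun p : ℝ × E k => (p.1, p.1 ^ b • p.2)) '' (Set.Icc 0 1 ×ˢ S), f p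
        ∂((volume : Measure ℝ).prod (volume : Measure (E k))) =
      ∫ y in S, ∫ s in (0 : ℝ)..1, s ^ (b * k) * f (s, s ^ b • y) := by
  set Q := (fun p : ℝ × E k => (p.1, p.1 ^ b • p.2)) '' (Set.Icc 0 1 ×ˢ S) with hQ
  have hQc : IsCompact Q := (isCompact_Icc.prod hS).image (by fun_prop)
  have hfi : IntegrableOn f Q ((volume : Measure ℝ).prod (volume : Measure (E k))) :=
    hf.continuousOn.integrableOn_compact hQc
  rw [← integral_indicator hQc.measurableSet,
    integral_prod _ ((integrable_indicator_iff hQc.measurableSet).mpr hfi)]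
  have hslice : ∀ s : ℝ, s ≠ 0 → ∫ z : E k, Q.indicator f (s, z) =
      (Set.Icc (0 : ℝ) 1).indicator
        (fun s => ∫ y in S, s ^ (b * k) * f (s, s ^ b • y)) s := by
    intro s hs
    by_cases hmem : s ∈ Set.Icc (0 : ℝ) 1
    · have hpos : 0 < s ^ b := pow_pos (lt_of_le_of_ne hmem.1 hs.symm) b
      have hiff : ∀ z, (s, z) ∈ Q ↔ z ∈ s ^ b • S := fun z => by
        constructor
        · rintro ⟨⟨s', y⟩, ⟨_, hy⟩, h⟩
          obtain ⟨h1, h2⟩ := Prod.mk.inj h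
          dsimp only at h1 h2
          subst h1
          exact ⟨y, hy, h2⟩
        · rintro ⟨y, hy, rfl⟩
          exact ⟨(s, y), ⟨hmem, hy⟩, rfl⟩
      have hind : (fun z : E k => Q.indicator f (s, z)) =
          (s ^ b • S).indicator (fun z => f (s, z)) := by
        ext z
        by_cases h : z ∈ s ^ b • S
        · rw [Set.indicator_of_mem h, Set.indicator_of_mem ((hiff z).mpr h)]
        · rw [Set.indicator_of_notMem h, Set.indicator_of_notMem (fun h' => h ((hiff z).mp h'))]
      have hsc := Measure.setIntegral_comp_smul_of_pos (volume : Measure (E k))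
        (fun z => f (s, z)) S hpos
      rw [Set.indicator_of_mem hmem, hind, integral_indicator (hS.smul _).measurableSet,
        integral_const_mul, hsc, finrank_euclideanSpace_fin, smul_eq_mul, ← mul_assoc, pow_mul,
        mul_inv_cancel₀ (pow_ne_zero _ hpos.ne'), one_mul]
    · rw [Set.indicator_of_notMem hmem]
      refine (integral_congr_ae (Filter.Eventually.of_forall fun z => ?_)).trans
        (integral_zero _ _)
      refine Set.indicator_of_notMem ?_ _
      rintro ⟨⟨s', y⟩, ⟨hs', _⟩, h⟩
      exact hmem ((Prod.mk.inj h).1 ▸ hs')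
  -- The slice at the apex is degenerate for b = 1, but a single height is a null set.
  have hae : ∀ᵐ s : ℝ, s ≠ 0 := by simp [ae_iff]
  rw [integral_congr_ae (hae.mono hslice), integral_indicator measurableSet_Icc,
    integral_integral_swap]
  · simp_rw [intervalIntegral.integral_of_le zero_le_one, integral_Icc_eq_integral_Ioc]
  · rw [Measure.prod_restrict]
    refine ContinuousOn.integrableOn_compact (isCompact_Icc.prod hS) (Continuous.continuousOn ?_)
    simp only [Function.uncurry_def]
    fun_prop

/-- An affine chart of an element `K` with a facet `F`: the element is the image of a cone
(`b = 1`) or of a prism (`b = 0`) of unit height over `S`, and the facet is the image of the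
base. -/
structure FacetChart {k : ℕ} (K F : Set (E (k + 1))) where
  origin : E (k + 1)
  toEquiv : (ℝ × E k) ≃L[ℝ] E (k + 1)
  b : ℕ
  b_le : b ≤ 1
  S : Set (E k)
  compact : IsCompact S
  volume_pos : 0 < volume S
  image_eq : K = (fun p : ℝ × E k => origin + toEquiv p) ''
    ((fun p : ℝ × E k => (p.1, p.1 ^ b • p.2)) '' (Set.Icc 0 1 ×ˢ S))
  facet_eq : F = (fun y : E k => origin + toEquiv (1, y)) '' S

/-- Integrals over an affine image of a set are proportional to integrals over the set. -/
theorem exists_setIntegral_image_eq {k : ℕ} (c : E (k + 1)) (T : (ℝ × E k) ≃L[ℝ] E (k + 1)) :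
    ∃ J : ℝ, 0 < J ∧ ∀ (Q : Set (ℝ × E k)) (f : E (k + 1) → ℝ),
      ∫ x in (fun p => c + T p) '' Q, f x = J * ∫ p in Q, f (c + T p)
        ∂((volume : Measure ℝ).prod (volume : Measure (E k))) := by
  -- The push-forward of Lebesgue measure under T is a Haar measure, so uniqueness supplies the
  -- Jacobian without a determinant.
  let μ : Measure (E (k + 1)) := ((volume : Measure ℝ).prod (volume : Measure (E k))).map T
  have hμ : μ.IsAddHaarMeasure := ContinuousLinearEquiv.isAddHaarMeasure_map T _
  have hvol : (volume : Measure (E (k + 1))) = Measure.addHaarScalarFactor volume μ • μ :=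
    Measure.isAddLeftInvariant_eq_smul _ _
  let g : (ℝ × E k) ≃ₜ E (k + 1) := T.toHomeomorph.trans (Homeomorph.addLeft c)
  have hg : ((volume : Measure ℝ).prod (volume : Measure (E k))).map g = μ := by
    have h1 : μ.map (fun x => c + x) = μ := map_add_left_eq_self μ c
    rw [← h1, Measure.map_map (by fun_prop) (by fun_prop)]
    rfl
  refine ⟨Measure.addHaarScalarFactor volume μ,
    Measure.addHaarScalarFactor_pos_of_isAddHaarMeasure _ _, fun Q f => ?_⟩
  have hemb : MeasurableEmbedding g := g.measurableEmbedding
  have himg : (fun p => c + T p) '' Q = g '' Q := rfl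
  conv_lhs => rw [hvol]
  have hint : ∫ x in g '' Q, f x ∂μ = ∫ p in Q, f (c + T p)
      ∂((volume : Measure ℝ).prod (volume : Measure (E k))) := by
    rw [← hg, hemb.setIntegral_map, Set.preimage_image_eq _ g.injective]
    rfl
  rw [Measure.restrict_smul, integral_smul_nnreal_measure, himg, hint]
  rfl

/-- Surface integrals over an affine image of a set are proportional to integrals over the
set. -/
theorem exists_surf_image_eq {k : ℕ} (c : E (k + 1)) (T : (ℝ × E k) ≃L[ℝ] E (k + 1)) :
    ∃ J : ℝ, 0 ≤ J ∧
      (∀ S : Set (E k), surf (k + 1) ((fun y => c + T (1, y)) '' S) =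
        ENNReal.ofReal J * volume S) ∧
      ∀ (S : Set (E k)) (f : E (k + 1) → ℝ), MeasurableSet S →
        ∫ x in (fun y => c + T (1, y)) '' S, f x ∂(surf (k + 1)) =
          J * ∫ y in S, f (c + T (1, y)) := by
  let L : E k →ₗ[ℝ] E (k + 1) := T.toLinearEquiv.toLinearMap ∘ₗ LinearMap.inr ℝ ℝ (E k)
  have hL : ∀ y, T (1, y) = T (1, 0) + L y := fun y => by
    simp [L, ← map_add]
  have hmeas : ∀ S : Set (E k), surf (k + 1) ((fun y => c + T (1, y)) '' S) =
      ENNReal.ofReal L.normDet * volume S := fun S => by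
    have h1 := L.euclideanHausdorffMeasure_image_eq_normDet_mul_volume S
    rw [finrank_euclideanSpace_fin] at h1
    have h2 : (fun y => c + T (1, y)) '' S =
        (IsometryEquiv.addLeft (c + T (1, 0))) '' (L '' S) := by
      rw [Set.image_image]
      refine Set.image_congr fun y _ => ?_
      simp [hL y, add_assoc]
    rw [h2, (IsometryEquiv.isometry _).euclideanHausdorffMeasure_image]
    exact h1
  refine ⟨L.normDet, L.normDet_nonneg, hmeas, fun S f hS => ?_⟩
  have hemb : MeasurableEmbedding (fun y : E k => c + T (1, y)) := by
    refine Topology.IsClosedEmbedding.measurableEmbedding ?_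
    have h3 : Topology.IsClosedEmbedding (fun y : E k => ((1 : ℝ), y)) := by
      refine Topology.IsClosedEmbedding.of_continuous_injective_isClosedMap (by fun_prop)
        (fun a b h => (Prod.mk.inj h).2) fun s hs => ?_
      have : (fun y : E k => ((1 : ℝ), y)) '' s = {1} ×ˢ s := by
        ext ⟨a, y⟩
        simp [eq_comm, and_comm]
      rw [this]
      exact isClosed_singleton.prod hs
    exact ((Homeomorph.addLeft c).isClosedEmbedding.comp T.toHomeomorph.isClosedEmbedding).comp h3
  -- The measures of images determine the pulled-back surface measure, a multiple of Lebesgue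
  -- measure. The integral formula is then a change of variables.
  have hcomap : (surf (k + 1)).comap (fun y : E k => c + T (1, y)) =
      ENNReal.ofReal L.normDet • (volume : Measure (E k)) := by
    ext s hs
    rw [hemb.comap_apply, hmeas]
    rfl
  have hsub : (fun y : E k => c + T (1, y)) '' S ⊆ Set.range (fun y : E k => c + T (1, y)) :=
    Set.image_subset_range _ _
  have hres : (surf (k + 1)).restrict ((fun y => c + T (1, y)) '' S) =
      (((surf (k + 1)).comap (fun y : E k => c + T (1, y))).map
        (fun y : E k => c + T (1, y))).restrict ((fun y => c + T (1, y)) '' S) := by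
    rw [hemb.map_comap, Measure.restrict_restrict (hemb.measurableSet_image.mpr hS),
      Set.inter_eq_left.mpr hsub]
  rw [hres, hemb.setIntegral_map, Set.preimage_image_eq _ hemb.injective, hcomap,
    Measure.restrict_smul, integral_smul_measure, ENNReal.toReal_ofReal L.normDet_nonneg,
    smul_eq_mul]

theorem totalDegree_pderiv_le {σ : Type*} (f : MvPolynomial σ ℝ) (i : σ) :
    (MvPolynomial.pderiv i f).totalDegree ≤ f.totalDegree - 1 := by
  classical
  rw [MvPolynomial.totalDegree]
  refine Finset.sup_le fun m hm => ?_
  rw [MvPolynomial.mem_support_iff, MvPolynomial.coeff_pderiv] at hm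
  have h1 := MvPolynomial.le_totalDegree
    (MvPolynomial.mem_support_iff.mpr (left_ne_zero_of_mul hm))
  rw [Finsupp.sum_add_index' (fun _ => rfl) (fun _ _ _ => rfl), Finsupp.sum_single_index rfl] at h1
  omega

theorem continuous_eval_ofLp {d : ℕ} (g : MvPolynomial (Fin d) ℝ) :
    Continuous fun x : E d => MvPolynomial.eval x.ofLp g :=
  (MvPolynomial.continuous_eval g).comp (PiLp.continuous_ofLp 2 _)

/-! ### The trace inequality on an element -/

namespace FacetChart

variable {k : ℕ} {K F : Set (E (k + 1))}

theorem isCompact_elem (Φ : FacetChart K F) : IsCompact K := by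
  rw [Φ.image_eq]
  exact ((isCompact_Icc.prod Φ.compact).image (by fun_prop)).image (by fun_prop)

theorem isCompact_facet (Φ : FacetChart K F) : IsCompact F := by
  rw [Φ.facet_eq]
  exact Φ.compact.image (by fun_prop)

theorem volume_real_pos (Φ : FacetChart K F) : 0 < (volume : Measure (E k)).real Φ.S :=
  ENNReal.toReal_pos Φ.volume_pos.ne' Φ.compact.measure_lt_top.ne

/-- The restriction of a polynomial to a ray of the chart is a polynomial of the same degree. -/
theorem exists_ray_polynomial (Φ : FacetChart K F)
    (g : MvPolynomial (Fin (k + 1)) ℝ) {n : ℕ} (hg : g.totalDegree ≤ n)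
    (y : E k) : ∃ q : Polynomial ℝ, q.natDegree ≤ n ∧ ∀ s : ℝ,
      q.eval s = MvPolynomial.eval (Φ.origin + Φ.toEquiv (s, s ^ Φ.b • y)).ofLp g := by
  let f : Fin (k + 1) → Polynomial ℝ := fun i =>
    Polynomial.C (Φ.origin i) + Polynomial.C ((Φ.toEquiv (1, 0)) i) * Polynomial.X ^ 1 +
      Polynomial.C ((Φ.toEquiv (0, y)) i) * Polynomial.X ^ Φ.b
  -- Since b ≤ 1, rays are affine in s, so substitution does not raise the degree.
  have hf : ∀ i, (f i).natDegree ≤ 1 := fun i => by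
    refine Polynomial.natDegree_add_le_of_degree_le
      (Polynomial.natDegree_add_le_of_degree_le (by simp) (Polynomial.natDegree_C_mul_X_pow_le _ _))
      ((Polynomial.natDegree_C_mul_X_pow_le _ _).trans Φ.b_le)
  refine ⟨MvPolynomial.aeval f g, by simpa using MvPolynomial.aeval_natDegree_le g hg f hf,
    fun s => ?_⟩
  have hT : Φ.toEquiv (s, s ^ Φ.b • y) =
      s • Φ.toEquiv (1, 0) + s ^ Φ.b • Φ.toEquiv (0, y) := by
    rw [← map_smul, ← map_smul, ← map_add]
    simp
  rw [hT, ← Polynomial.coe_evalRingHom, MvPolynomial.aeval_def, MvPolynomial.hom_eval₂]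
  rw [MvPolynomial.eval, MvPolynomial.coe_eval₂Hom]
  congr 1
  · ext; simp
  · ext i
    simp [f]
    ring

/-- The data of the chart that enter the trace inequality: the Jacobians of the element and of the
facet. -/
theorem exists_jacobians (Φ : FacetChart K F) : ∃ J J' : ℝ, 0 < J ∧ 0 ≤ J' ∧
    (∀ f : E (k + 1) → ℝ, Continuous f → ∫ x in K, f x = J * ∫ y in Φ.S, ∫ s in (0 : ℝ)..1,
      s ^ (Φ.b * k) * f (Φ.origin + Φ.toEquiv (s, s ^ Φ.b • y))) ∧
    surf (k + 1) F = ENNReal.ofReal J' * volume Φ.S ∧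
    ∀ f : E (k + 1) → ℝ, ∫ x in F, f x ∂(surf (k + 1)) =
      J' * ∫ y in Φ.S, f (Φ.origin + Φ.toEquiv (1, y)) := by
  obtain ⟨J, hJ, hJint⟩ := exists_setIntegral_image_eq Φ.origin Φ.toEquiv
  obtain ⟨J', hJ', hmeas, hJ'int⟩ := exists_surf_image_eq Φ.origin Φ.toEquiv
  refine ⟨J, J', hJ, hJ', fun f hf => ?_, ?_, fun f => ?_⟩
  · rw [← setIntegral_image_cone Φ.b Φ.compact
      (f := fun p => f (Φ.origin + Φ.toEquiv p)) (by fun_prop), ← hJint, ← Φ.image_eq]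
  · rw [← hmeas, ← Φ.facet_eq]
  · rw [← hJ'int _ _ Φ.compact.measurableSet, ← Φ.facet_eq]

theorem surf_facet_lt_top (Φ : FacetChart K F) : surf (k + 1) F < ⊤ := by
  obtain ⟨J, J', _, _, _, h, _⟩ := Φ.exists_jacobians
  rw [h]
  exact ENNReal.mul_lt_top ENNReal.ofReal_lt_top Φ.compact.measure_lt_top

/-- Take f = 1. The denominator comes from integrating s^(bk): it is k + 1 for a cone and 1 for a
prism. -/
theorem volume_real_eq (Φ : FacetChart K F) {J : ℝ}
    (h : ∀ f : E (k + 1) → ℝ, Continuous f → ∫ x in K, f x = J * ∫ y in Φ.S, ∫ s in (0 : ℝ)..1,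
      s ^ (Φ.b * k) * f (Φ.origin + Φ.toEquiv (s, s ^ Φ.b • y))) :
    (volume : Measure (E (k + 1))).real K =
      J * (volume : Measure (E k)).real Φ.S / ((Φ.b * k : ℕ) + 1) := by
  have := h (fun _ => 1) continuous_const
  simp only [mul_one, integral_pow, setIntegral_const, smul_eq_mul] at this
  rw [this]
  simp
  ring

theorem volume_elem_pos (Φ : FacetChart K F) : 0 < (volume : Measure (E (k + 1))).real K := by
  obtain ⟨J, J', hJ, _, h, _⟩ := Φ.exists_jacobians
  rw [Φ.volume_real_eq h]
  have := Φ.volume_real_pos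
  positivity

/-- The trace inequality for polynomials of degree at most `n` on an element. -/
theorem trace_inequality (Φ : FacetChart K F)
    (g : MvPolynomial (Fin (k + 1)) ℝ) {n : ℕ} (hg : g.totalDegree ≤ n) :
    (volume : Measure (E (k + 1))).real K *
        ∫ x in F, MvPolynomial.eval x.ofLp g ^ 2 ∂(surf (k + 1)) ≤
      (n + 1) ^ 2 * (surf (k + 1)).real F * ∫ x in K, MvPolynomial.eval x.ofLp g ^ 2 := by
  obtain ⟨J, J', hJ, hJ', hK, hF, hFint⟩ := Φ.exists_jacobians
  have hgc := continuous_eval_ofLp g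
  have hvF : (surf (k + 1)).real F = J' * (volume : Measure (E k)).real Φ.S := by
    rw [Measure.real, hF, ENNReal.toReal_mul, ENNReal.toReal_ofReal hJ']
    rfl
  rw [Φ.volume_real_eq hK, hvF, hFint,
    hK (fun x => MvPolynomial.eval x.ofLp g ^ 2) (hgc.pow 2)]
  have hV := Φ.volume_real_pos
  set V := (volume : Measure (E k)).real Φ.S
  set m := Φ.b * k with hm
  set I := ∫ y in Φ.S, ∫ s in (0 : ℝ)..1,
    s ^ m * MvPolynomial.eval (Φ.origin + Φ.toEquiv (s, s ^ Φ.b • y)).ofLp g ^ 2 with hI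
  have hc : Continuous (Function.uncurry fun (y : E k) (s : ℝ) =>
      s ^ m * MvPolynomial.eval (Φ.origin + Φ.toEquiv (s, s ^ Φ.b • y)).ofLp g ^ 2) := by
    simp only [Function.uncurry_def]
    refine (by fun_prop : Continuous fun p : E k × ℝ => p.2 ^ m).mul (Continuous.pow ?_ 2)
    exact hgc.comp (by fun_prop)
  have hci : Continuous fun y : E k => ∫ s in (0 : ℝ)..1,
      s ^ m * MvPolynomial.eval (Φ.origin + Φ.toEquiv (s, s ^ Φ.b • y)).ofLp g ^ 2 :=
    intervalIntegral.continuous_parametric_intervalIntegral_of_continuous' hc 0 1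
  have hInn : 0 ≤ I := integral_nonneg fun y => intervalIntegral.integral_nonneg zero_le_one
    fun s hs => mul_nonneg (pow_nonneg hs.1 _) (sq_nonneg _)
  have key : ∫ y in Φ.S, MvPolynomial.eval (Φ.origin + Φ.toEquiv (1, y)).ofLp g ^ 2 ≤
      (n + 1) * (n + 1 + m) * I := by
    rw [hI, ← integral_const_mul]
    refine setIntegral_mono ?_ ?_ fun y => ?_
    · refine Continuous.continuousOn ?_ |>.integrableOn_compact Φ.compact
      exact (hgc.comp (by fun_prop : Continuous fun y : E k => Φ.origin + Φ.toEquiv (1, y))).pow 2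
    · exact (continuous_const.mul hci).continuousOn.integrableOn_compact Φ.compact
    · obtain ⟨q, hq, hqe⟩ := Φ.exists_ray_polynomial g hg y
      have := sq_eval_one_le n m q hq
      simp only [hqe, one_pow, one_smul] at this
      exact this
  -- The factor m + 1 cancels the one in |K|, so cones and prisms share the constant (n+1)². The
  -- loss is (n+1)nm.
  have hcoef : ((n : ℝ) + 1) * (n + 1 + m) ≤ (n + 1) ^ 2 * (m + 1) := by
    have : (0 : ℝ) ≤ (n + 1) * (n * m) := by positivity
    nlinarith
  calc J * V / ((m : ℕ) + 1) *
        (J' * ∫ y in Φ.S, MvPolynomial.eval (Φ.origin + Φ.toEquiv (1, y)).ofLp g ^ 2)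
      ≤ J * V / ((m : ℕ) + 1) * (J' * ((n + 1) ^ 2 * (m + 1) * I)) := by
        have := key.trans (mul_le_mul_of_nonneg_right hcoef hInn)
        gcongr
    _ = (n + 1) ^ 2 * (J' * V) * (J * I) := by
        have : (m : ℝ) + 1 ≠ 0 := by positivity
        field_simp

end FacetChart

/-! ### Charts for simplices and parallelotopes -/

/-- The linear parametrisation by an edge `u` transversal to the facet and edges `w j` of the
facet. -/
theorem exists_edge_equiv {k : ℕ} (u : E (k + 1)) (w : Fin k → E (k + 1))
    (h : ∀ (σ : ℝ) (y : Fin k → ℝ), σ • u + ∑ j, y j • w j = 0 → σ = 0 ∧ y = 0) :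
    ∃ T : (ℝ × E k) ≃L[ℝ] E (k + 1), ∀ (σ : ℝ) (y : E k), T (σ, y) = σ • u + ∑ j, y j • w j := by
  let f : (ℝ × E k) →ₗ[ℝ] E (k + 1) := (LinearMap.toSpanSingleton ℝ _ u).coprod
    (Fintype.linearCombination ℝ w ∘ₗ (WithLp.linearEquiv 2 ℝ (Fin k → ℝ)).toLinearMap)
  have hf : ∀ (σ : ℝ) (y : E k), f (σ, y) = σ • u + ∑ j, y j • w j := fun σ y => by
    simp [f, Fintype.linearCombination_apply]
  have hinj : Function.Injective f := by
    rw [← LinearMap.ker_eq_bot, LinearMap.ker_eq_bot']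
    rintro ⟨σ, y⟩ hy
    obtain ⟨h1, h2⟩ := h σ y.ofLp ((hf σ y).symm.trans hy)
    ext i
    · exact h1
    · exact congrFun h2 i
  let T : (ℝ × E k) ≃ₗ[ℝ] E (k + 1) := f.linearEquivOfInjective hinj (by simp [add_comm])
  exact ⟨T.toContinuousLinearEquiv, hf⟩

/-- Reduces a chart to edge coordinates: c is the apex of the cone or a corner of the face opposite
to F, and u leads from c to F. -/
theorem nonempty_facetChart {k : ℕ} {K F : Set (E (k + 1))} (c u : E (k + 1))
    (w : Fin k → E (k + 1))
    (h : ∀ (σ : ℝ) (y : Fin k → ℝ), σ • u + ∑ j, y j • w j = 0 → σ = 0 ∧ y = 0)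
    {b : ℕ} (hb : b ≤ 1) {S : Set (E k)} (hS : IsCompact S) (hpos : 0 < volume S)
    (hK : ∀ x, x ∈ K ↔ ∃ σ ∈ Set.Icc (0 : ℝ) 1, ∃ y ∈ S,
      x = c + (σ • u + σ ^ b • ∑ j, y j • w j))
    (hF : ∀ x, x ∈ F ↔ ∃ y ∈ S, x = c + (u + ∑ j, y j • w j)) :
    Nonempty (FacetChart K F) := by
  obtain ⟨T, hT⟩ := exists_edge_equiv u w h
  refine ⟨⟨c, T, b, hb, S, hS, hpos, ?_, ?_⟩⟩
  · ext x
    rw [hK, Set.image_image]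
    constructor
    · rintro ⟨σ, hσ, y, hy, rfl⟩
      exact ⟨(σ, y), ⟨hσ, hy⟩, by simp [hT, Finset.smul_sum, mul_smul]⟩
    · rintro ⟨⟨σ, y⟩, ⟨hσ, hy⟩, rfl⟩
      exact ⟨σ, hσ, y, hy, by simp [hT, Finset.smul_sum, mul_smul]⟩
  · ext x
    rw [hF]
    constructor
    · rintro ⟨y, hy, rfl⟩
      exact ⟨y, hy, by simp [hT]⟩
    · rintro ⟨y, hy, rfl⟩
      exact ⟨y, hy, by simp [hT]⟩

/-- The unit cube. -/
def unitCube (k : ℕ) : Set (E k) := {y | ∀ j, y j ∈ Set.Icc (0 : ℝ) 1}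

/-- The unit simplex with a vertex at the origin. -/
def unitSimplex (k : ℕ) : Set (E k) := {y | (∀ j, 0 ≤ y j) ∧ ∑ j, y j ≤ 1}

theorem isCompact_unitCube (k : ℕ) : IsCompact (unitCube k) := by
  have h : unitCube k = WithLp.toLp 2 '' (Set.univ.pi fun _ : Fin k => Set.Icc (0 : ℝ) 1) := by
    ext y
    constructor
    · exact fun hy => ⟨y.ofLp, fun j _ => hy j, rfl⟩
    · rintro ⟨z, hz, rfl⟩
      exact fun j => hz j (Set.mem_univ j)
  rw [h]
  exact (isCompact_univ_pi fun _ => isCompact_Icc).image (PiLp.continuous_toLp 2 _)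

theorem isCompact_unitSimplex (k : ℕ) : IsCompact (unitSimplex k) := by
  refine (isCompact_unitCube k).of_isClosed_subset ?_ fun y hy j => ⟨hy.1 j, ?_⟩
  · refine IsClosed.inter (s₁ := {y : E k | ∀ j, 0 ≤ y j}) ?_ ?_
    · rw [Set.ofPred_forall]
      exact isClosed_iInter fun j => isClosed_le continuous_const (by fun_prop)
    · exact isClosed_le (f := fun y : E k => ∑ j, y j) (by fun_prop) continuous_const
  · exact (Finset.single_le_sum (fun l _ => hy.1 l) (Finset.mem_univ j)).trans hy.2

theorem volume_unitSimplex_pos (k : ℕ) : 0 < volume (unitSimplex k) := by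
  let U : Set (E k) := {y | (∀ j, 0 < y j) ∧ ∑ j, y j < 1}
  have hU : IsOpen U := by
    refine IsOpen.inter (s := {y : E k | ∀ j, 0 < y j}) ?_ ?_
    · rw [Set.ofPred_forall]
      exact isOpen_iInter_of_finite fun j => isOpen_lt continuous_const (by fun_prop)
    · exact isOpen_lt (f := fun y : E k => ∑ j, y j) (by fun_prop) continuous_const
  have hne : U.Nonempty := by
    refine ⟨WithLp.toLp 2 fun _ => 1 / ((k : ℝ) + 1), fun j => ?_, ?_⟩
    · simp only
      positivity
    · simp only [Finset.sum_const, Finset.card_univ, Fintype.card_fin, nsmul_eq_mul]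
      rw [mul_one_div, div_lt_one (by positivity)]
      linarith
  exact (hU.measure_pos volume hne).trans_le
    (measure_mono fun y hy => ⟨fun j => (hy.1 j).le, hy.2.le⟩)

theorem volume_unitCube_pos (k : ℕ) : 0 < volume (unitCube k) :=
  (volume_unitSimplex_pos k).trans_le <| measure_mono fun _ hy j => ⟨hy.1 j,
    (Finset.single_le_sum (fun l _ => hy.1 l) (Finset.mem_univ j)).trans hy.2⟩

theorem mem_convexHull_range_iff {ι V : Type*} [Fintype ι] [AddCommGroup V] [Module ℝ V]
    (v : ι → V) (x : V) : x ∈ convexHull ℝ (Set.range v) ↔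
      ∃ w : ι → ℝ, (∀ i, 0 ≤ w i) ∧ ∑ i, w i = 1 ∧ x = ∑ i, w i • v i := by
  classical
  have h : Set.range v = Fintype.linearCombination ℝ v '' Set.range fun i : ι => Pi.single i 1 := by
    rw [← Set.range_comp]
    congr 1
    ext i
    simp
  rw [h, ← LinearMap.image_convexHull, convexHull_rangle_single_eq_stdSimplex]
  constructor
  · rintro ⟨w, hw, rfl⟩
    exact ⟨w, hw.1, hw.2, Fintype.linearCombination_apply ℝ v w⟩
  · rintro ⟨w, h0, h1, rfl⟩
    exact ⟨w, ⟨h0, h1⟩, Fintype.linearCombination_apply ℝ v w⟩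

/-- The prism rises from the opposite facet, so its height is t_i if s = 1 and 1 - t_i if s = 0. The
sign 2s - 1 and the involution in `hflip` treat both cases at once. -/
theorem nonempty_facetChart_parallelotope {k : ℕ} (x₀ : E (k + 1)) (a : Fin (k + 1) → E (k + 1))
    (ha : LinearIndependent ℝ a) (F : Set (E (k + 1)))
    (hF : F ∈ (Cell.parallelotope x₀ a ha).facets) :
    Nonempty (FacetChart (Cell.parallelotope x₀ a ha).carrier F) := by
  obtain ⟨i, s, hs, rfl⟩ := hF
  have hs2 : (2 * s - 1) * (2 * s - 1) = 1 := by rcases hs with rfl | rfl <;> norm_num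
  have hflip : ∀ σ ∈ Set.Icc (0 : ℝ) 1, 1 - s + (2 * s - 1) * σ ∈ Set.Icc (0 : ℝ) 1 := by
    rintro σ ⟨h0, h1⟩
    rcases hs with rfl | rfl <;> constructor <;> linarith
  refine nonempty_facetChart (b := 0) (x₀ + (1 - s) • a i) ((2 * s - 1) • a i)
    (fun j => a (i.succAbove j)) ?_ zero_le_one (isCompact_unitCube k) (volume_unitCube_pos k)
    (fun x => ?_) fun x => ?_
  · intro σ y h
    have := Fintype.linearIndependent_iff.mp ha (i.insertNth (σ * (2 * s - 1)) y)
      (by rw [Fin.sum_univ_succAbove _ i]; simpa [mul_smul] using h)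
    refine ⟨?_, funext fun j => by simpa using this (i.succAbove j)⟩
    have h1 : σ * (2 * s - 1) = 0 := by simpa using this i
    calc σ = σ * (2 * s - 1) * (2 * s - 1) := by rw [mul_assoc, hs2, mul_one]
      _ = 0 := by rw [h1, zero_mul]
  · constructor
    · rintro ⟨t, ht, rfl⟩
      refine ⟨_, hflip _ (ht i), WithLp.toLp 2 fun j => t (i.succAbove j), fun j => ht _, ?_⟩
      rw [Fin.sum_univ_succAbove _ i]
      have : t i = (1 - s) + (1 - s + (2 * s - 1) * t i) * (2 * s - 1) := by
        linear_combination (1 / 2 - t i) * hs2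
      simp only [pow_zero, one_smul, smul_smul]
      conv_lhs => rw [this, add_smul]
      abel
    · rintro ⟨σ, hσ, y, hy, rfl⟩
      refine ⟨i.insertNth (1 - s + (2 * s - 1) * σ) y, fun l => ?_, ?_⟩
      · refine Fin.succAboveCases i ?_ (fun j => ?_) l
        · simpa using hflip σ hσ
        · simpa using hy j
      · rw [Fin.sum_univ_succAbove _ i]
        simp only [Fin.insertNth_apply_same, Fin.insertNth_apply_succAbove, add_smul, smul_smul,
          pow_zero, one_smul, mul_comm σ]
        abel
  · constructor
    · rintro ⟨t, ht, hti, rfl⟩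
      refine ⟨WithLp.toLp 2 fun j => t (i.succAbove j), fun j => ht _, ?_⟩
      rw [Fin.sum_univ_succAbove _ i, hti]
      have : s = (1 - s) + (2 * s - 1) := by ring
      conv_lhs => rw [this, add_smul]
      abel
    · rintro ⟨y, hy, rfl⟩
      refine ⟨i.insertNth s y, fun l => ?_, by simp, ?_⟩
      · refine Fin.succAboveCases i ?_ (fun j => ?_) l
        · rcases hs with rfl | rfl <;> simp
        · simpa using hy j
      · rw [Fin.sum_univ_succAbove _ i]
        simp only [Fin.insertNth_apply_same, Fin.insertNth_apply_succAbove]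
        have : s = (1 - s) + (2 * s - 1) := by ring
        conv_rhs => rw [this, add_smul]
        abel

/-- The cone has its apex at the vertex omitted from F. Its height is one minus the barycentric
coordinate of that vertex, and the position in the base is given by the remaining coordinates
divided by the height. -/
theorem nonempty_facetChart_simplex {k : ℕ} (v : Fin (k + 1 + 1) → E (k + 1))
    (hv : AffineIndependent ℝ v) (F : Set (E (k + 1)))
    (hF : F ∈ (Cell.simplex v hv).facets) :
    Nonempty (FacetChart (Cell.simplex v hv).carrier F) := by
  obtain ⟨i, rfl⟩ := hF
  have hsum : ∀ (α β : ℝ) (γ : Fin k → ℝ),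
      ∑ l, (i.insertNth α (Fin.cons β γ) : Fin (k + 1 + 1) → ℝ) l = α + (β + ∑ j, γ j) := by
    intro α β γ
    rw [Fin.sum_univ_succAbove _ i, Fin.sum_univ_succ]
    simp
  have hcomb : ∀ (α β : ℝ) (γ : Fin k → ℝ),
      ∑ l, (i.insertNth α (Fin.cons β γ) : Fin (k + 1 + 1) → ℝ) l • v l =
        α • v i + (β • v (i.succAbove 0) + ∑ j, γ j • v (i.succAbove j.succ)) := by
    intro α β γ
    rw [Fin.sum_univ_succAbove _ i, Fin.sum_univ_succ]
    simp
  have hedge : ∀ y : Fin k → ℝ,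
      ∑ j, y j • (v (i.succAbove j.succ) - v (i.succAbove 0)) =
        ∑ j, y j • v (i.succAbove j.succ) - (∑ j, y j) • v (i.succAbove 0) := by
    intro y
    simp_rw [smul_sub, Finset.sum_sub_distrib, Finset.sum_smul]
  refine nonempty_facetChart (b := 1) (v i) (v (i.succAbove 0) - v i)
    (fun j => v (i.succAbove j.succ) - v (i.succAbove 0)) ?_ le_rfl (isCompact_unitSimplex k)
    (volume_unitSimplex_pos k) (fun x => ?_) fun x => ?_
  · intro σ y h
    -- In terms of vertices, the vanishing combination of edges has these coefficients, whose sum is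
    -- zero.
    have h0 := affineIndependent_iff.mp hv Finset.univ
      (i.insertNth (-σ) (Fin.cons (σ - ∑ j, y j) y)) (by rw [hsum]; ring)
      (by
        rw [hcomb, ← h, hedge]
        module)
    refine ⟨by simpa using h0 i (Finset.mem_univ _), funext fun j => ?_⟩
    simpa using h0 (i.succAbove j.succ) (Finset.mem_univ _)
  · rw [Cell.carrier, mem_convexHull_range_iff]
    constructor
    · rintro ⟨w, hw0, hw1, rfl⟩
      rw [Fin.sum_univ_succAbove _ i, Fin.sum_univ_succ] at hw1
      set σ := w (i.succAbove 0) + ∑ j : Fin k, w (i.succAbove j.succ) with hσ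
      have hsn : 0 ≤ ∑ j : Fin k, w (i.succAbove j.succ) :=
        Finset.sum_nonneg fun j _ => hw0 _
      have hσ0 : 0 ≤ σ := add_nonneg (hw0 _) hsn
      -- At the apex all other coordinates vanish, so the quotients by σ = 0, which default to 0,
      -- are still a valid choice of y.
      have hz : σ = 0 → ∀ j : Fin k, w (i.succAbove j.succ) = 0 := fun h j =>
        (Finset.sum_eq_zero_iff_of_nonneg fun j _ => hw0 _).mp
          (by linarith [hw0 (i.succAbove 0)] : ∑ j : Fin k, w (i.succAbove j.succ) = 0) j
          (Finset.mem_univ _)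
      refine ⟨σ, ⟨hσ0, by linarith [hw0 i]⟩,
        WithLp.toLp 2 fun j => w (i.succAbove j.succ) / σ, ⟨fun j => ?_, ?_⟩, ?_⟩
      · exact div_nonneg (hw0 _) hσ0
      · simp only [← Finset.sum_div]
        exact div_le_one_of_le₀ (by linarith [hw0 (i.succAbove 0)]) hσ0
      · have hmul : ∀ j : Fin k, σ * (w (i.succAbove j.succ) / σ) = w (i.succAbove j.succ) :=
          fun j => by
            by_cases h : σ = 0
            · rw [hz h j]; simp
            · field_simp
        rw [Fin.sum_univ_succAbove _ i, Fin.sum_univ_succ, pow_one, Finset.smul_sum]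
        simp_rw [smul_smul, hmul, hedge fun j => w (i.succAbove j.succ)]
        rw [eq_sub_of_add_eq hw1]
        have : w (i.succAbove 0) = σ - ∑ j : Fin k, w (i.succAbove j.succ) := by linarith
        rw [this]
        module
    · rintro ⟨σ, ⟨h0, h1⟩, y, ⟨hy0, hy1⟩, rfl⟩
      refine ⟨i.insertNth (1 - σ) (Fin.cons (σ * (1 - ∑ j, y j)) fun j => σ * y j), fun l => ?_,
        ?_, ?_⟩
      · refine Fin.succAboveCases i ?_ (fun j => ?_) l
        · simpa using h1
        · refine Fin.cases ?_ (fun j => ?_) j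
          · simpa using mul_nonneg h0 (sub_nonneg.mpr hy1)
          · simpa using mul_nonneg h0 (hy0 j)
      · rw [hsum, ← Finset.mul_sum]
        ring
      · rw [hcomb, hedge, pow_one]
        simp_rw [mul_smul, ← Finset.smul_sum]
        module
  · rw [← Fin.range_succAbove, ← Set.range_comp, mem_convexHull_range_iff]
    constructor
    · rintro ⟨w, hw0, hw1, rfl⟩
      rw [Fin.sum_univ_succ] at hw1
      refine ⟨WithLp.toLp 2 fun j => w j.succ, ⟨fun j => hw0 _, ?_⟩, ?_⟩
      · simp only
        linarith [hw0 0]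
      · rw [Fin.sum_univ_succ, hedge fun j => w j.succ, eq_sub_of_add_eq hw1]
        simp only [Function.comp_apply]
        module
    · rintro ⟨y, ⟨hy0, hy1⟩, rfl⟩
      refine ⟨Fin.cons (1 - ∑ j, y j) y, fun l => ?_, ?_, ?_⟩
      · refine Fin.cases ?_ (fun j => ?_) l
        · simpa using hy1
        · simpa using hy0 j
      · rw [Fin.sum_univ_succ]
        simp
      · rw [Fin.sum_univ_succ, hedge]
        simp only [Function.comp_apply, Fin.cons_zero, Fin.cons_succ]
        module

/-- Every facet of an element has a chart. -/
theorem Cell.nonempty_facetChart {k : ℕ} (K : Cell (k + 1)) {F : Set (E (k + 1))}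
    (hF : F ∈ K.facets) : Nonempty (FacetChart K.carrier F) := by
  cases K with
  | simplex v hv => exact nonempty_facetChart_simplex v hv F hF
  | parallelotope x₀ a ha => exact nonempty_facetChart_parallelotope x₀ a ha F hF

theorem Cell.facets_nonempty {k : ℕ} (K : Cell (k + 1)) : K.facets.Nonempty := by
  cases K with
  | simplex v hv => exact ⟨_, 0, rfl⟩
  | parallelotope x₀ a ha => exact ⟨_, 0, 0, Or.inl rfl, rfl⟩

theorem Cell.isCompact_carrier {k : ℕ} (K : Cell (k + 1)) : IsCompact K.carrier :=
  have ⟨_, hF⟩ := K.facets_nonempty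
  have ⟨Φ⟩ := K.nonempty_facetChart hF
  Φ.isCompact_elem

theorem Cell.vol_pos {k : ℕ} (K : Cell (k + 1)) : 0 < K.vol :=
  have ⟨_, hF⟩ := K.facets_nonempty
  have ⟨Φ⟩ := K.nonempty_facetChart hF
  Φ.volume_elem_pos

theorem lengthScale_comm {d : ℕ} (K L : Cell d) : lengthScale K L = lengthScale L K := by
  rw [lengthScale, lengthScale, Set.inter_comm]
  ring

/-! ### Pointwise estimates for the mobility fluxes -/

theorem haver_pos {a b : ℝ} (ha : 0 < a) (hb : 0 < b) : 0 < haver a b := by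
  unfold haver
  positivity

theorem Scheme.faceMobility_pos (s : Scheme) {a b : ℝ} (ha : 0 < a) (hb : 0 < b) :
    0 < s.faceMobility a b := by
  cases s with
  | swip => exact haver_pos ha hb
  | sipg => exact lt_max_of_lt_left ha

/-- The only quantitative property of the flux that coercivity uses; past this point both schemes
are treated alike. -/
theorem Scheme.two_mul_abs_inner_flux_le {d : ℕ} (s : Scheme) {a b : ℝ} (ha : 0 < a) (hb : 0 < b)
    (G H n : E d) : 2 * |inner ℝ (s.flux a b G H) n| ≤
      s.faceMobility a b * (|inner ℝ G n| + |inner ℝ H n|) := by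
  cases s with
  | swip =>
    simp only [Scheme.flux, Scheme.faceMobility, real_inner_smul_left, inner_add_left, abs_mul,
      abs_of_pos (haver_pos ha hb)]
    have h := mul_le_mul_of_nonneg_left (abs_add_le (inner ℝ G n) (inner ℝ H n))
      (haver_pos ha hb).le
    rw [abs_of_pos (by norm_num : (0 : ℝ) < 1 / 2)]
    linarith
  | sipg =>
    simp only [Scheme.flux, Scheme.faceMobility, real_inner_smul_left, inner_add_left, abs_mul]
    have h := abs_add_le (a * inner ℝ G n) (b * inner ℝ H n)
    rw [abs_mul, abs_mul, abs_of_pos ha, abs_of_pos hb] at h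
    have h1 := mul_le_mul_of_nonneg_right (le_max_left a b) (abs_nonneg (inner ℝ G n))
    have h2 := mul_le_mul_of_nonneg_right (le_max_right a b) (abs_nonneg (inner ℝ H n))
    rw [abs_of_pos (by norm_num : (0 : ℝ) < 1 / 2)]
    linarith

theorem continuousOn_haver {X : Type*} [TopologicalSpace X] {s : Set X} {a b : X → ℝ}
    (ha : ContinuousOn a s) (hb : ContinuousOn b s) (ha' : ∀ x ∈ s, 0 < a x)
    (hb' : ∀ x ∈ s, 0 < b x) : ContinuousOn (fun x => haver (a x) (b x)) s :=
  ((continuousOn_const.mul ha).mul hb).div (ha.add hb)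
    fun x hx => (add_pos (ha' x hx) (hb' x hx)).ne'

theorem Scheme.continuousOn_faceMobility (s : Scheme) {X : Type*} [TopologicalSpace X] {t : Set X}
    {a b : X → ℝ} (ha : ContinuousOn a t) (hb : ContinuousOn b t) (ha' : ∀ x ∈ t, 0 < a x)
    (hb' : ∀ x ∈ t, 0 < b x) : ContinuousOn (fun x => s.faceMobility (a x) (b x)) t := by
  cases s with
  | swip => exact continuousOn_haver ha hb ha' hb'
  | sipg => exact ha.sup hb

theorem Scheme.continuousOn_flux (s : Scheme) {d : ℕ} {X : Type*} [TopologicalSpace X] {t : Set X}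
    {a b : X → ℝ} {G H : X → E d} (ha : ContinuousOn a t) (hb : ContinuousOn b t)
    (ha' : ∀ x ∈ t, 0 < a x) (hb' : ∀ x ∈ t, 0 < b x) (hG : ContinuousOn G t)
    (hH : ContinuousOn H t) : ContinuousOn (fun x => s.flux (a x) (b x) (G x) (H x)) t := by
  have hhalf : ContinuousOn (fun _ : X => (1 / 2 : ℝ)) t := continuousOn_const
  cases s with
  | swip => exact (continuousOn_haver ha hb ha' hb').smul (hhalf.smul (hG.add hH))
  | sipg => exact hhalf.smul ((ha.smul hG).add (hb.smul hH))

/-- Young's inequality for the consistency term on a face. -/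
theorem consistency_le_of_sq_le {f μ g₁ g₂ j A B ε : ℝ} (hf : 2 * |f| ≤ μ * (|g₁| + |g₂|))
    (hμ : μ ^ 2 ≤ A * B) (hA : 0 ≤ A) (hB : 0 ≤ B) (hε : 0 < ε) :
    2 * (f * j) ≤ ε⁻¹ * A * (g₁ ^ 2 + g₂ ^ 2) + ε / 2 * B * j ^ 2 := by
  set G := |g₁| + |g₂| with hG
  have hGn : 0 ≤ G := by positivity
  have hG2 : G ^ 2 ≤ 2 * (g₁ ^ 2 + g₂ ^ 2) := by
    rw [← sq_abs g₁, ← sq_abs g₂]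
    nlinarith [sq_nonneg (|g₁| - |g₂|)]
  have h1 : 2 * (f * j) ≤ μ * G * |j| := by
    calc 2 * (f * j) ≤ 2 * |f * j| := by linarith [le_abs_self (f * j)]
      _ = 2 * |f| * |j| := by rw [abs_mul]; ring
      _ ≤ _ := mul_le_mul_of_nonneg_right hf (abs_nonneg j)
  -- Comparing squares, 4uw ≤ (u + w)², avoids dividing by A or B.
  have h2 : μ * G * |j| ≤ ε⁻¹ / 2 * A * G ^ 2 + ε / 2 * B * j ^ 2 := by
    refine le_of_sq_le_sq ?_ (by positivity)
    set u := ε⁻¹ / 2 * A * G ^ 2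
    set w := ε / 2 * B * j ^ 2
    have h3 : (μ * G * |j|) ^ 2 ≤ 4 * (u * w) := by
      calc (μ * G * |j|) ^ 2 = μ ^ 2 * (G ^ 2 * j ^ 2) := by rw [mul_pow, mul_pow, sq_abs]; ring
        _ ≤ A * B * (G ^ 2 * j ^ 2) := by gcongr
        _ = 4 * (u * w) := by simp only [u, w]; field_simp; ring
    nlinarith [sq_nonneg (u - w)]
  have h4 : ε⁻¹ / 2 * A * G ^ 2 ≤ ε⁻¹ / 2 * A * (2 * (g₁ ^ 2 + g₂ ^ 2)) := by gcongr
  linarith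

/-! ### Broken polynomials -/

namespace Broken

variable {d N : ℕ} (υ : Broken d N)

theorem continuous_val (i : Fin N) : Continuous (υ.val i) := continuous_eval_ofLp _

theorem continuous_grad (i : Fin N) : Continuous (υ.grad i) :=
  (PiLp.continuous_toLp 2 _).comp (continuous_pi fun _ => continuous_eval_ofLp _)

theorem continuous_jump (e : Fin N × Fin N) : Continuous (υ.jump e) :=
  (υ.continuous_val _).sub (υ.continuous_val _)

/-- A directional derivative as a polynomial. -/
noncomputable def dirDeriv (i : Fin N) (n : E d) : MvPolynomial (Fin d) ℝ :=
  ∑ k, MvPolynomial.C (n k) * MvPolynomial.pderiv k (υ i)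

theorem eval_dirDeriv (i : Fin N) (n x : E d) :
    MvPolynomial.eval x.ofLp (υ.dirDeriv i n) = inner ℝ (υ.grad i x) n := by
  simp [dirDeriv, grad, PiLp.inner_apply]

theorem totalDegree_dirDeriv_le (i : Fin N) (n : E d) :
    (υ.dirDeriv i n).totalDegree ≤ (υ i).totalDegree - 1 :=
  MvPolynomial.totalDegree_finsetSum_le fun k _ =>
    (MvPolynomial.totalDegree_mul _ _).trans (by
      rw [MvPolynomial.totalDegree_C, zero_add]
      exact totalDegree_pderiv_le _ _)

end Broken

/-! ### Faces of the mesh -/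

namespace Mesh

variable {k N : ℕ} (𝒯 : Mesh (k + 1) N)

theorem isCompact_elem (i : Fin N) : IsCompact (𝒯.elem i) := (𝒯.cell i).isCompact_carrier

theorem elem_nonempty (i : Fin N) : (𝒯.elem i).Nonempty := by
  rw [Set.nonempty_iff_ne_empty]
  intro h
  have h1 := (𝒯.cell i).vol_pos
  rw [Cell.vol, show (𝒯.cell i).carrier = ∅ from h] at h1
  simp at h1

theorem isCompact_face (e : Fin N × Fin N) : IsCompact (𝒯.face e) :=
  (𝒯.isCompact_elem _).inter (𝒯.isCompact_elem _)

theorem mem_faces {e : Fin N × Fin N} :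
    e ∈ 𝒯.faces ↔ e.1 < e.2 ∧ 0 < surf (k + 1) (𝒯.face e) := by
  simp [faces]

/-- Two elements `i`, `j` with an intersection of positive surface measure: the intersection has a
finite surface measure, and it satisfies the trace inequality from the side of `i`. -/
theorem intersection_spec {i j : Fin N} (hij : i ≠ j)
    (hpos : 0 < surf (k + 1) (𝒯.elem i ∩ 𝒯.elem j)) :
    surf (k + 1) (𝒯.elem i ∩ 𝒯.elem j) < ⊤ ∧ 0 < lengthScale (𝒯.cell i) (𝒯.cell j) ∧
      ∀ (g : MvPolynomial (Fin (k + 1)) ℝ) (n : ℕ), g.totalDegree ≤ n →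
        lengthScale (𝒯.cell i) (𝒯.cell j) *
            ∫ x in 𝒯.elem i ∩ 𝒯.elem j, MvPolynomial.eval x.ofLp g ^ 2 ∂(surf (k + 1)) ≤
          2 * (n + 1) ^ 2 * ∫ x in 𝒯.elem i, MvPolynomial.eval x.ofLp g ^ 2 := by
  obtain ⟨F, hF, hsub, hsize⟩ := 𝒯.facet_of_intersection i j hij hpos
  obtain ⟨Φ⟩ := (𝒯.cell i).nonempty_facetChart hF
  have hfin : surf (k + 1) (𝒯.elem i ∩ 𝒯.elem j) < ⊤ :=
    (measure_mono hsub).trans_lt Φ.surf_facet_lt_top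
  have hreal : 0 < (surf (k + 1)).real (𝒯.elem i ∩ 𝒯.elem j) :=
    ENNReal.toReal_pos hpos.ne' hfin.ne
  have hKi := (𝒯.cell i).vol_pos
  have hKj := (𝒯.cell j).vol_pos
  have hh : 0 < lengthScale (𝒯.cell i) (𝒯.cell j) :=
    div_pos (by positivity) (mul_pos hreal (by positivity))
  have hsize' : (surf (k + 1)).real F * lengthScale (𝒯.cell i) (𝒯.cell j) ≤
      2 * (𝒯.cell i).vol := by
    -- For e = F the bound is automatic: |e| h_e = 2|K||L| / (|K| + |L|) ≤ 2|K|.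
    rcases hsize with rfl | h
    · have h1 : (surf (k + 1)).real ((𝒯.cell i).carrier ∩ (𝒯.cell j).carrier) ≠ 0 := hreal.ne'
      rw [lengthScale, mul_div_assoc', mul_div_mul_left _ _ h1, div_le_iff₀ (by positivity)]
      nlinarith [mul_pos hKi hKi]
    · exact h
  refine ⟨hfin, hh, fun g n hg => ?_⟩
  set h := lengthScale (𝒯.cell i) (𝒯.cell j)
  have htr := Φ.trace_inequality g hg
  have hFin : IntegrableOn (fun x : E (k + 1) => MvPolynomial.eval x.ofLp g ^ 2) F
      (surf (k + 1)) := by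
    -- Hausdorff measure of codimension one is not locally finite on the whole space, so
    -- integrability of continuous functions is obtained after restriction to F.
    have : IsFiniteMeasure ((surf (k + 1)).restrict F) :=
      ⟨by rw [Measure.restrict_apply_univ]; exact Φ.surf_facet_lt_top⟩
    have := ((continuous_eval_ofLp g).pow 2).continuousOn.integrableOn_compact
      (μ := (surf (k + 1)).restrict F) Φ.isCompact_facet
    rwa [IntegrableOn, Measure.restrict_restrict_of_subset le_rfl] at this
  have hmono : ∫ x in 𝒯.elem i ∩ 𝒯.elem j, MvPolynomial.eval x.ofLp g ^ 2 ∂(surf (k + 1)) ≤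
      ∫ x in F, MvPolynomial.eval x.ofLp g ^ 2 ∂(surf (k + 1)) :=
    setIntegral_mono_set hFin (Filter.Eventually.of_forall fun _ => sq_nonneg _)
      (Filter.Eventually.of_forall hsub)
  set I := ∫ x in 𝒯.elem i, MvPolynomial.eval x.ofLp g ^ 2
  have hI : 0 ≤ I := integral_nonneg fun _ => sq_nonneg _
  have hKpos : 0 < (𝒯.cell i).vol := hKi
  refine le_of_mul_le_mul_left ?_ hKpos
  calc (𝒯.cell i).vol *
        (h * ∫ x in 𝒯.elem i ∩ 𝒯.elem j, MvPolynomial.eval x.ofLp g ^ 2 ∂(surf (k + 1)))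
      ≤ h * ((𝒯.cell i).vol * ∫ x in F, MvPolynomial.eval x.ofLp g ^ 2 ∂(surf (k + 1))) := by
        rw [mul_left_comm]
        gcongr
    _ ≤ h * ((n + 1) ^ 2 * (surf (k + 1)).real F * I) :=
        mul_le_mul_of_nonneg_left htr hh.le
    _ = (n + 1) ^ 2 * I * ((surf (k + 1)).real F * h) := by ring
    _ ≤ (n + 1) ^ 2 * I * (2 * (𝒯.cell i).vol) := by gcongr
    _ = (𝒯.cell i).vol * (2 * (n + 1) ^ 2 * I) := by ring

variable {𝒯}

theorem surf_face_lt_top {e : Fin N × Fin N} (he : e ∈ 𝒯.faces) :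
    surf (k + 1) (𝒯.face e) < ⊤ :=
  (𝒯.intersection_spec (𝒯.mem_faces.mp he).1.ne (𝒯.mem_faces.mp he).2).1

theorem h_pos {e : Fin N × Fin N} (he : e ∈ 𝒯.faces) : 0 < 𝒯.h e :=
  (𝒯.intersection_spec (𝒯.mem_faces.mp he).1.ne (𝒯.mem_faces.mp he).2).2.1

theorem face_nonempty {e : Fin N × Fin N} (he : e ∈ 𝒯.faces) : (𝒯.face e).Nonempty :=
  nonempty_of_measure_ne_zero (𝒯.mem_faces.mp he).2.ne'

theorem integrableOn_face {e : Fin N × Fin N} (he : e ∈ 𝒯.faces) {f : E (k + 1) → ℝ}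
    (hf : ContinuousOn f (𝒯.face e)) : IntegrableOn f (𝒯.face e) (surf (k + 1)) := by
  have : IsFiniteMeasure ((surf (k + 1)).restrict (𝒯.face e)) :=
    ⟨by rw [Measure.restrict_apply_univ]; exact surf_face_lt_top he⟩
  have := hf.integrableOn_compact (μ := (surf (k + 1)).restrict (𝒯.face e)) (𝒯.isCompact_face e)
  rwa [IntegrableOn, Measure.restrict_restrict_of_subset le_rfl] at this

/-- The trace inequality for the normal derivative, from either side of a face. -/
theorem h_mul_integral_inner_grad_le {e : Fin N × Fin N} (he : e ∈ 𝒯.faces) {i : Fin N}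
    (hi : i = e.1 ∨ i = e.2) (υ : Broken (k + 1) N) {p : ℕ} (hp : 1 ≤ p)
    (hυ : (υ i).totalDegree ≤ p) :
    𝒯.h e * ∫ x in 𝒯.face e, (inner ℝ (υ.grad i x) (𝒯.normal e.1 e.2)) ^ 2 ∂(surf (k + 1)) ≤
      2 * (p : ℝ) ^ 2 * ∫ x in 𝒯.elem i, ‖υ.grad i x‖ ^ 2 := by
  obtain ⟨hlt, hpos⟩ := 𝒯.mem_faces.mp he
  have hn := (𝒯.normal_spec e.1 e.2 hlt hpos).1
  set n := 𝒯.normal e.1 e.2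
  -- The normal is constant on the face, so the normal derivative is a polynomial of degree at most
  -- p - 1. With p ≥ 1, this turns (n+1)² into p².
  have hdeg : (υ.dirDeriv i n).totalDegree ≤ p - 1 :=
    (υ.totalDegree_dirDeriv_le i n).trans (Nat.sub_le_sub_right hυ 1)
  have hcast : ((p - 1 : ℕ) : ℝ) + 1 = p := by
    rw [Nat.cast_sub hp]
    simp
  have key : 𝒯.h e * ∫ x in 𝒯.face e, MvPolynomial.eval x.ofLp (υ.dirDeriv i n) ^ 2
        ∂(surf (k + 1)) ≤
      2 * (p : ℝ) ^ 2 * ∫ x in 𝒯.elem i, MvPolynomial.eval x.ofLp (υ.dirDeriv i n) ^ 2 := by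
    rw [← hcast]
    rcases hi with rfl | rfl
    · exact (𝒯.intersection_spec hlt.ne hpos).2.2 _ _ hdeg
    · have := (𝒯.intersection_spec hlt.ne'
        (by rw [Set.inter_comm]; exact hpos)).2.2 _ _ hdeg
      rwa [lengthScale_comm, Set.inter_comm] at this
  simp_rw [Broken.eval_dirDeriv] at key
  refine key.trans ?_
  gcongr 2 * (p : ℝ) ^ 2 * ?_
  refine setIntegral_mono ?_ ?_ fun x => ?_
  · exact (((υ.continuous_grad i).inner continuous_const).pow 2).continuousOn.integrableOn_compact
      (𝒯.isCompact_elem i)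
  · exact ((υ.continuous_grad i).norm.pow 2).continuousOn.integrableOn_compact (𝒯.isCompact_elem i)
  · have := abs_real_inner_le_norm (υ.grad i x) n
    rw [hn, mul_one] at this
    rw [← sq_abs]
    exact pow_le_pow_left₀ (abs_nonneg _) this 2

end Mesh

/-! ### The contrast -/

section contrast

variable {k N : ℕ} {𝒯 : Mesh (k + 1) N} {s : Scheme} {m : Fin N → E (k + 1) → ℝ} {δ : ℝ}

theorem continuousOn_faceMob (hm : ∀ i, Continuous (m i))
    (hδ : 0 < δ) (hmδ : ∀ i, ∀ x ∈ 𝒯.elem i, δ ≤ m i x) (e : Fin N × Fin N) :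
    ContinuousOn (faceMob s m e) (𝒯.face e) :=
  s.continuousOn_faceMobility (hm _).continuousOn (hm _).continuousOn
    (fun x hx => hδ.trans_le (hmδ _ x hx.1)) fun x hx => hδ.trans_le (hmδ _ x hx.2)

theorem faceMob_pos (hδ : 0 < δ) (hmδ : ∀ i, ∀ x ∈ 𝒯.elem i, δ ≤ m i x) {e : Fin N × Fin N}
    {x : E (k + 1)} (hx : x ∈ 𝒯.face e) : 0 < faceMob s m e x :=
  s.faceMobility_pos (hδ.trans_le (hmδ _ x hx.1)) (hδ.trans_le (hmδ _ x hx.2))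

/-- Continuity on the compact face bounds the image, so that `sSup` is a genuine supremum. -/
theorem faceMob_le_sSup (hm : ∀ i, Continuous (m i))
    (hδ : 0 < δ) (hmδ : ∀ i, ∀ x ∈ 𝒯.elem i, δ ≤ m i x) {e : Fin N × Fin N} {x : E (k + 1)}
    (hx : x ∈ 𝒯.face e) : faceMob s m e x ≤ sSup (faceMob s m e '' 𝒯.face e) :=
  le_csSup ((𝒯.isCompact_face e).bddAbove_image (continuousOn_faceMob hm hδ hmδ e))
    (Set.mem_image_of_mem _ hx)

theorem sSup_faceMob_pos (hm : ∀ i, Continuous (m i))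
    (hδ : 0 < δ) (hmδ : ∀ i, ∀ x ∈ 𝒯.elem i, δ ≤ m i x) {e : Fin N × Fin N} (he : e ∈ 𝒯.faces) :
    0 < sSup (faceMob s m e '' 𝒯.face e) :=
  have ⟨_, hx⟩ := Mesh.face_nonempty he
  (faceMob_pos hδ hmδ hx).trans_le (faceMob_le_sSup hm hδ hmδ hx)

theorem sInf_mobility_pos (hδ : 0 < δ) (hmδ : ∀ i, ∀ x ∈ 𝒯.elem i, δ ≤ m i x) (i : Fin N) :
    0 < sInf (m i '' 𝒯.elem i) :=
  hδ.trans_le <| le_csInf ((𝒯.elem_nonempty i).image _) <| by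
    rintro _ ⟨x, hx, rfl⟩
    exact hmδ i x hx

theorem sInf_mobility_le (hmδ : ∀ i, ∀ x ∈ 𝒯.elem i, δ ≤ m i x) {i : Fin N} {x : E (k + 1)}
    (hx : x ∈ 𝒯.elem i) : sInf (m i '' 𝒯.elem i) ≤ m i x :=
  csInf_le ⟨δ, by rintro _ ⟨y, hy, rfl⟩; exact hmδ i y hy⟩ (Set.mem_image_of_mem _ hx)

open scoped Classical in
theorem sum_sSup_le_contrast_mul (hδ : 0 < δ) (hmδ : ∀ i, ∀ x ∈ 𝒯.elem i, δ ≤ m i x) (α : ℝ)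
    (i : Fin N) :
    ∑ e ∈ 𝒯.faces.filter (fun e => e.1 = i ∨ e.2 = i),
        sSup (faceMob s m e '' 𝒯.face e) ^ (2 - 2 * α) ≤
      contrast 𝒯 s α m * sInf (m i '' 𝒯.elem i) := by
  rw [← div_le_iff₀ (sInf_mobility_pos hδ hmδ i), Finset.sum_div]
  exact le_ciSup (f := fun i : Fin N => ∑ e ∈ 𝒯.faces.filter (fun e => e.1 = i ∨ e.2 = i),
    sSup (faceMob s m e '' 𝒯.face e) ^ (2 - 2 * α) / sInf (m i '' 𝒯.elem i))
    (Set.finite_range _).bddAbove i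

/-- A single face already gives its element `e.1` a positive sum. This permits division by λ* in the
face estimate. -/
theorem contrast_pos (hm : ∀ i, Continuous (m i))
    (hδ : 0 < δ) (hmδ : ∀ i, ∀ x ∈ 𝒯.elem i, δ ≤ m i x) (α : ℝ) {e : Fin N × Fin N}
    (he : e ∈ 𝒯.faces) : 0 < contrast 𝒯 s α m := by
  classical
  have h1 := sum_sSup_le_contrast_mul (s := s) hδ hmδ α e.1
  have hpos : ∀ e' ∈ 𝒯.faces, 0 < sSup (faceMob s m e' '' 𝒯.face e') ^ (2 - 2 * α) :=
    fun e' he' => Real.rpow_pos_of_pos (sSup_faceMob_pos hm hδ hmδ he') _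
  have h2 : 0 < ∑ e' ∈ 𝒯.faces.filter (fun e' => e'.1 = e.1 ∨ e'.2 = e.1),
      sSup (faceMob s m e' '' 𝒯.face e') ^ (2 - 2 * α) :=
    Finset.sum_pos (fun e' he' => hpos e' (Finset.mem_filter.mp he').1)
      ⟨e, Finset.mem_filter.mpr ⟨he, Or.inl rfl⟩⟩
  exact pos_of_mul_pos_left (h2.trans_le (by convert h1)) (sInf_mobility_pos hδ hmδ _).le

/-- Summing the face contributions of the element energies is controlled by the contrast. -/
theorem sum_faces_le_contrast_mul (hm : ∀ i, Continuous (m i))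
    (hδ : 0 < δ) (hmδ : ∀ i, ∀ x ∈ 𝒯.elem i, δ ≤ m i x) (α : ℝ) (hc : 0 ≤ contrast 𝒯 s α m)
    (υ : Broken (k + 1) N) :
    ∑ e ∈ 𝒯.faces, sSup (faceMob s m e '' 𝒯.face e) ^ (2 - 2 * α) *
        ((∫ x in 𝒯.elem e.1, ‖υ.grad e.1 x‖ ^ 2) + ∫ x in 𝒯.elem e.2, ‖υ.grad e.2 x‖ ^ 2) ≤
      contrast 𝒯 s α m * ∑ i, ∫ x in 𝒯.elem i, m i x * ‖υ.grad i x‖ ^ 2 := by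
  classical
  set S : Fin N × Fin N → ℝ := fun e => sSup (faceMob s m e '' 𝒯.face e) ^ (2 - 2 * α)
  set D : Fin N → ℝ := fun i => ∫ x in 𝒯.elem i, ‖υ.grad i x‖ ^ 2
  have hD : ∀ i, 0 ≤ D i := fun i => integral_nonneg fun _ => sq_nonneg _
  -- Double counting: each face belongs to exactly two distinct elements.
  have hswap : ∑ e ∈ 𝒯.faces, S e * (D e.1 + D e.2) =
      ∑ i, D i * ∑ e ∈ 𝒯.faces.filter (fun e => e.1 = i ∨ e.2 = i), S e := by
    simp_rw [Finset.sum_filter, Finset.mul_sum]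
    rw [Finset.sum_comm]
    refine Finset.sum_congr rfl fun e he => ?_
    have hne := (𝒯.mem_faces.mp he).1.ne
    have : ∀ i, D i * (if e.1 = i ∨ e.2 = i then S e else 0) =
        (if e.1 = i then D i * S e else 0) + (if e.2 = i then D i * S e else 0) := by
      intro i
      by_cases h1 : e.1 = i
      · have h2 : e.2 ≠ i := fun h => hne (h1.trans h.symm)
        simp [h1, h2]
      · simp [h1]
    simp_rw [this, Finset.sum_add_distrib, Finset.sum_ite_eq, Finset.mem_univ, if_true]
    ring
  change ∑ e ∈ 𝒯.faces, S e * (D e.1 + D e.2) ≤ _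
  rw [hswap, Finset.mul_sum]
  refine Finset.sum_le_sum fun i _ => ?_
  have h1 : ∑ e ∈ 𝒯.faces.filter (fun e => e.1 = i ∨ e.2 = i), S e ≤
      contrast 𝒯 s α m * sInf (m i '' 𝒯.elem i) := by
    convert sum_sSup_le_contrast_mul (s := s) hδ hmδ α i
  have h2 : sInf (m i '' 𝒯.elem i) * D i ≤ ∫ x in 𝒯.elem i, m i x * ‖υ.grad i x‖ ^ 2 := by
    rw [← integral_const_mul]
    have hc2 := (υ.continuous_grad i).norm.pow 2
    refine setIntegral_mono_on ?_ ?_ (𝒯.isCompact_elem i).measurableSet fun x hx => ?_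
    · exact (continuous_const.mul hc2).continuousOn.integrableOn_compact (𝒯.isCompact_elem i)
    · exact ((hm i).mul hc2).continuousOn.integrableOn_compact (𝒯.isCompact_elem i)
    · exact mul_le_mul_of_nonneg_right (sInf_mobility_le hmδ hx) (sq_nonneg _)
  calc D i * _ ≤ D i * (contrast 𝒯 s α m * sInf (m i '' 𝒯.elem i)) :=
        mul_le_mul_of_nonneg_left h1 (hD i)
    _ = contrast 𝒯 s α m * (sInf (m i '' 𝒯.elem i) * D i) := by ring
    _ ≤ _ := mul_le_mul_of_nonneg_left h2 hc

end contrast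

/-! ### Absorbing the consistency terms -/

section coercivity

variable {k N : ℕ} {𝒯 : Mesh (k + 1) N} {s : Scheme} {m : Fin N → E (k + 1) → ℝ} {δ : ℝ}

/-- Here k = d - 1. After inserting the lower bound on η, the claim reduces to p ≤ Pk, which is
where d ≥ 2 enters. -/
theorem natCast_sq_mul_le {p P k : ℕ} {η : ℝ} (hp : p ≤ P) (hk : 1 ≤ k)
    (hη : (p : ℝ) * (p + (k + 1 : ℕ) - 1) ≤ η) : (p : ℝ) ^ 2 * (P + 1) ≤ P * η := by
  have hp' : (p : ℝ) ≤ P := by exact_mod_cast hp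
  have hk' : (1 : ℝ) ≤ k := by exact_mod_cast hk
  have hp0 : (0 : ℝ) ≤ p := p.cast_nonneg
  have h1 : (P : ℝ) * (p * (p + (k + 1 : ℕ) - 1)) ≤ P * η :=
    mul_le_mul_of_nonneg_left hη P.cast_nonneg
  push_cast at h1
  have h2 : (p : ℝ) ≤ P * k := by nlinarith
  nlinarith

/-- Lower bound for the contribution of a face to the form. -/
theorem face_coercivity (hm : ∀ i, Continuous (m i)) (hδ : 0 < δ)
    (hmδ : ∀ i, ∀ x ∈ 𝒯.elem i, δ ≤ m i x) (hk : 1 ≤ k) {P : ℕ} {p : Fin N → ℕ}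
    (hp : ∀ i, 1 ≤ p i ∧ p i ≤ P) {α : ℝ} (hα : α ≤ 1 / 2) {e : Fin N × Fin N}
    (he : e ∈ 𝒯.faces) {η : ℝ}
    (hη : max ((p e.1 : ℝ) * (p e.1 + (k + 1 : ℕ) - 1)) ((p e.2 : ℝ) * (p e.2 + (k + 1 : ℕ) - 1))
      ≤ η)
    {Λ : E (k + 1) → ℝ} (hΛ : IntegrableOn Λ (𝒯.face e) (surf (k + 1)))
    (hΛle : ∀ x ∈ 𝒯.face e, faceMob s m e x ^ (2 * α) * contrast 𝒯 s α m ≤ Λ x)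
    {υ : Broken (k + 1) N} (hυ : υ ∈ Broken.space p) :
    (1 / (2 * (P + 1) : ℝ)) * (∫ x in 𝒯.face e, Λ x * η / 𝒯.h e * υ.jump e x ^ 2 ∂(surf (k + 1))) -
      2 * P / (2 * P + 1) / contrast 𝒯 s α m *
        (sSup (faceMob s m e '' 𝒯.face e) ^ (2 - 2 * α) *
          ((∫ x in 𝒯.elem e.1, ‖υ.grad e.1 x‖ ^ 2) + ∫ x in 𝒯.elem e.2, ‖υ.grad e.2 x‖ ^ 2)) ≤
    ∫ x in 𝒯.face e,
      (η * Λ x / 𝒯.h e * υ.jump e x * υ.jump e x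
        - inner ℝ (s.flux (m e.1 x) (m e.2 x) (υ.grad e.1 x) (υ.grad e.2 x)) (𝒯.normal e.1 e.2)
            * υ.jump e x
        - inner ℝ (s.flux (m e.1 x) (m e.2 x) (υ.grad e.1 x) (υ.grad e.2 x)) (𝒯.normal e.1 e.2)
            * υ.jump e x) ∂(surf (k + 1)) := by
  have hh := Mesh.h_pos he
  have hlam := contrast_pos (s := s) hm hδ hmδ α he
  have hSpos := Real.rpow_pos_of_pos (sSup_faceMob_pos (s := s) hm hδ hmδ he) (2 - 2 * α)
  have hP : (1 : ℝ) ≤ P := by exact_mod_cast (hp e.1).1.trans (hp e.1).2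
  have hp1 : (1 : ℝ) ≤ p e.1 := by exact_mod_cast (hp e.1).1
  have hη1 := natCast_sq_mul_le (hp e.1).2 hk ((le_max_left _ _).trans hη)
  have hη2 := natCast_sq_mul_le (hp e.2).2 hk ((le_max_right _ _).trans hη)
  have hηpos : 0 < η := by
    have h1 : (0 : ℝ) < (p e.1 : ℝ) ^ 2 * (P + 1) := by positivity
    exact pos_of_mul_pos_right (h1.trans_le hη1) (by positivity)
  have htr1 := Mesh.h_mul_integral_inner_grad_le he (Or.inl rfl) υ (hp e.1).1 (hυ e.1)
  have htr2 := Mesh.h_mul_integral_inner_grad_le he (Or.inr rfl) υ (hp e.2).1 (hυ e.2)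
  set lam := contrast 𝒯 s α m
  set S := sSup (faceMob s m e '' 𝒯.face e) ^ (2 - 2 * α) with hS
  set n := 𝒯.normal e.1 e.2
  set D₁ := ∫ x in 𝒯.elem e.1, ‖υ.grad e.1 x‖ ^ 2
  set D₂ := ∫ x in 𝒯.elem e.2, ‖υ.grad e.2 x‖ ^ 2
  have hD₁ : 0 ≤ D₁ := integral_nonneg fun _ => sq_nonneg _
  have hD₂ : 0 ≤ D₂ := integral_nonneg fun _ => sq_nonneg _
  -- Keeping part of the penalty needs ε < 2, and keeping part of the energy needs ε > 2P/(P+1).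
  -- This is the midpoint.
  set ε : ℝ := (2 * P + 1) / (P + 1) with hε
  have hεpos : 0 < ε := by positivity
  -- Chosen so that A times the penalty weight Λη/h_e is S Λ/λ*, which dominates M̃².
  set A := S * 𝒯.h e / (η * lam) with hA
  have hApos : 0 < A := by positivity
  let F : E (k + 1) → ℝ := fun x =>
    inner ℝ (s.flux (m e.1 x) (m e.2 x) (υ.grad e.1 x) (υ.grad e.2 x)) n
  let g₁ : E (k + 1) → ℝ := fun x => inner ℝ (υ.grad e.1 x) n
  let g₂ : E (k + 1) → ℝ := fun x => inner ℝ (υ.grad e.2 x) n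
  let B : E (k + 1) → ℝ := fun x => Λ x * η / 𝒯.h e * υ.jump e x ^ 2
  have hm1 : ∀ x ∈ 𝒯.face e, 0 < m e.1 x := fun x hx => hδ.trans_le (hmδ _ x hx.1)
  have hm2 : ∀ x ∈ 𝒯.face e, 0 < m e.2 x := fun x hx => hδ.trans_le (hmδ _ x hx.2)
  have hFint : IntegrableOn (fun x => F x * υ.jump e x) (𝒯.face e) (surf (k + 1)) :=
    Mesh.integrableOn_face he <| ((s.continuousOn_flux (hm _).continuousOn (hm _).continuousOn
      hm1 hm2 (υ.continuous_grad _).continuousOn (υ.continuous_grad _).continuousOn).inner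
      continuousOn_const).mul (υ.continuous_jump e).continuousOn
  have hg₁int : IntegrableOn (fun x => g₁ x ^ 2) (𝒯.face e) (surf (k + 1)) :=
    Mesh.integrableOn_face he
      (((υ.continuous_grad _).inner continuous_const).pow 2).continuousOn
  have hg₂int : IntegrableOn (fun x => g₂ x ^ 2) (𝒯.face e) (surf (k + 1)) :=
    Mesh.integrableOn_face he
      (((υ.continuous_grad _).inner continuous_const).pow 2).continuousOn
  -- Λ is merely integrable, but its cofactor is continuous on a compact face.
  have hBint : IntegrableOn B (𝒯.face e) (surf (k + 1)) := by
    have hc : ContinuousOn (fun x => η / 𝒯.h e * υ.jump e x ^ 2) (𝒯.face e) :=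
      (continuous_const.mul ((υ.continuous_jump e).pow 2)).continuousOn
    refine (hΛ.mul_continuousOn hc (𝒯.isCompact_face e)).congr_fun (fun x _ => ?_)
      (𝒯.isCompact_face e).measurableSet
    simp only [B]
    ring
  have hpt : ∀ x ∈ 𝒯.face e, (1 - ε / 2) * B x - ε⁻¹ * A * (g₁ x ^ 2 + g₂ x ^ 2) ≤
      B x - 2 * (F x * υ.jump e x) := by
    intro x hx
    have hμ := faceMob_pos (s := s) hδ hmδ hx
    have hΛx := hΛle x hx
    have hΛ0 : 0 ≤ Λ x := le_trans (by positivity) hΛx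
    have hμ2 : faceMob s m e x ^ 2 ≤ A * (Λ x * η / 𝒯.h e) := by
      have h1 : faceMob s m e x ^ 2 =
          faceMob s m e x ^ (2 - 2 * α) * faceMob s m e x ^ (2 * α) := by
        rw [← Real.rpow_add hμ, ← Real.rpow_natCast]
        norm_num
      have h2 : faceMob s m e x ^ (2 - 2 * α) ≤ S :=
        Real.rpow_le_rpow hμ.le (faceMob_le_sSup hm hδ hmδ hx) (by linarith)
      have h3 : faceMob s m e x ^ (2 * α) ≤ Λ x / lam := (le_div_iff₀ hlam).mpr hΛx
      have h4 : A * (Λ x * η / 𝒯.h e) = S * (Λ x / lam) := by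
        rw [hA]
        field_simp
      rw [h1, h4]
      exact mul_le_mul h2 h3 (by positivity) hSpos.le
    have := consistency_le_of_sq_le (j := υ.jump e x)
      (s.two_mul_abs_inner_flux_le (hm1 x hx) (hm2 x hx) (υ.grad e.1 x) (υ.grad e.2 x) n)
      hμ2 hApos.le (by positivity) hεpos
    simp only [B, F, g₁, g₂]
    linarith
  have hgint : IntegrableOn (fun x => g₁ x ^ 2 + g₂ x ^ 2) (𝒯.face e) (surf (k + 1)) :=
    hg₁int.add hg₂int
  have hlowint : IntegrableOn (fun x => (1 - ε / 2) * B x - ε⁻¹ * A * (g₁ x ^ 2 + g₂ x ^ 2))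
      (𝒯.face e) (surf (k + 1)) :=
    (hBint.const_mul (1 - ε / 2)).sub (hgint.const_mul (ε⁻¹ * A))
  have hupint : IntegrableOn (fun x => B x - 2 * (F x * υ.jump e x)) (𝒯.face e)
      (surf (k + 1)) :=
    hBint.sub (hFint.const_mul 2)
  have hint := setIntegral_mono_on hlowint hupint (𝒯.isCompact_face e).measurableSet hpt
  have hL : ∫ x in 𝒯.face e, ((1 - ε / 2) * B x - ε⁻¹ * A * (g₁ x ^ 2 + g₂ x ^ 2))
        ∂(surf (k + 1)) =
      (1 - ε / 2) * (∫ x in 𝒯.face e, B x ∂(surf (k + 1))) -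
        ε⁻¹ * A * ((∫ x in 𝒯.face e, g₁ x ^ 2 ∂(surf (k + 1))) +
          ∫ x in 𝒯.face e, g₂ x ^ 2 ∂(surf (k + 1))) := by
    rw [integral_sub (hBint.const_mul _) (hgint.const_mul _), integral_const_mul,
      integral_const_mul, integral_add hg₁int hg₂int]
  have hε2 : 1 - ε / 2 = 1 / (2 * (P + 1)) := by
    rw [hε]
    field_simp
    ring
  set G₁ := ∫ x in 𝒯.face e, g₁ x ^ 2 ∂(surf (k + 1))
  set G₂ := ∫ x in 𝒯.face e, g₂ x ^ 2 ∂(surf (k + 1))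
  -- The trace constant 2p² is divided by η here, and p²/η ≤ P/(P+1) on either side.
  have hG : 𝒯.h e / η * (G₁ + G₂) ≤ 2 * P / (P + 1) * (D₁ + D₂) := by
    rw [div_mul_eq_mul_div, div_mul_eq_mul_div, div_le_div_iff₀ hηpos (by positivity)]
    have h1 : 𝒯.h e * (G₁ + G₂) ≤ 2 * (p e.1 : ℝ) ^ 2 * D₁ + 2 * (p e.2 : ℝ) ^ 2 * D₂ := by
      rw [mul_add]
      exact add_le_add htr1 htr2
    have h2 := mul_le_mul_of_nonneg_right h1 (by positivity : (0 : ℝ) ≤ P + 1)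
    have h3 := mul_le_mul_of_nonneg_right hη1 hD₁
    have h4 := mul_le_mul_of_nonneg_right hη2 hD₂
    linarith
  have hAG : ε⁻¹ * A * (G₁ + G₂) ≤ 2 * P / (2 * P + 1) / lam * (S * (D₁ + D₂)) := by
    calc ε⁻¹ * A * (G₁ + G₂) = ε⁻¹ * S / lam * (𝒯.h e / η * (G₁ + G₂)) := by
          rw [hA]
          field_simp
      _ ≤ ε⁻¹ * S / lam * (2 * P / (P + 1) * (D₁ + D₂)) := by gcongr
      _ = _ := by
          rw [hε]
          field_simp
  rw [hL, hε2] at hint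
  refine (sub_le_sub_left hAG _).trans (hint.trans_eq ?_)
  refine integral_congr_ae (Filter.Eventually.of_forall fun x => ?_)
  simp only [B, F]
  ring

/-- Coercivity for a general elementwise mobility that is bounded below. -/
theorem seminormSq_le_form (hm : ∀ i, Continuous (m i)) (hδ : 0 < δ)
    (hmδ : ∀ i, ∀ x ∈ 𝒯.elem i, δ ≤ m i x) (hk : 1 ≤ k) {P : ℕ} {p : Fin N → ℕ}
    (hp : ∀ i, 1 ≤ p i ∧ p i ≤ P) {α : ℝ} (hα : α ≤ 1 / 2) {η : Fin N × Fin N → ℝ}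
    (hη : ∀ e ∈ 𝒯.faces, max ((p e.1 : ℝ) * (p e.1 + (k + 1 : ℕ) - 1))
      ((p e.2 : ℝ) * (p e.2 + (k + 1 : ℕ) - 1)) ≤ η e)
    {Λ : Fin N × Fin N → E (k + 1) → ℝ}
    (hΛ : ∀ e ∈ 𝒯.faces, IntegrableOn (Λ e) (𝒯.face e) (surf (k + 1)))
    (hΛle : ∀ e ∈ 𝒯.faces, ∀ x ∈ 𝒯.face e,
      faceMob s m e x ^ (2 * α) * contrast 𝒯 s α m ≤ Λ e x)
    {υ : Broken (k + 1) N} (hυ : υ ∈ Broken.space p) :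
    seminormSq 𝒯 η Λ m υ ≤ 2 * (P + 1) * form 𝒯 s η Λ m υ υ := by
  set lam := contrast 𝒯 s α m with hlam
  set A := ∑ i, ∫ x in 𝒯.elem i, m i x * ‖υ.grad i x‖ ^ 2 with hA
  set B := ∑ e ∈ 𝒯.faces, ∫ x in 𝒯.face e, Λ e x * η e / 𝒯.h e * υ.jump e x ^ 2 ∂(surf (k + 1))
    with hB
  have hAform : ∑ i, ∫ x in 𝒯.elem i, m i x * inner ℝ (υ.grad i x) (υ.grad i x) = A := by
    simp_rw [real_inner_self_eq_norm_sq, hA]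
  have hAnorm : ∑ i, ∫ x in 𝒯.elem i, ‖√(m i x) • υ.grad i x‖ ^ 2 = A :=
    Finset.sum_congr rfl fun i _ => setIntegral_congr_fun (𝒯.isCompact_elem i).measurableSet
      fun x hx => by
        have h0 : 0 ≤ m i x := hδ.le.trans (hmδ i x hx)
        simp only [norm_smul, mul_pow, Real.norm_eq_abs, sq_abs, Real.sq_sqrt h0]
  have hA0 : 0 ≤ A := Finset.sum_nonneg fun i _ =>
    setIntegral_nonneg (𝒯.isCompact_elem i).measurableSet fun x hx =>
      mul_nonneg (hδ.le.trans (hmδ i x hx)) (sq_nonneg _)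
  have hfaces := Finset.sum_le_sum fun e he =>
    face_coercivity hm hδ hmδ hk hp hα he (hη e he) (hΛ e he) (hΛle e he) hυ
  rw [Finset.sum_sub_distrib, ← Finset.mul_sum, ← Finset.mul_sum, ← hB] at hfaces
  have hsum : 2 * P / (2 * P + 1) / lam *
      ∑ e ∈ 𝒯.faces, (sSup (faceMob s m e '' 𝒯.face e) ^ (2 - 2 * α) *
        ((∫ x in 𝒯.elem e.1, ‖υ.grad e.1 x‖ ^ 2) + ∫ x in 𝒯.elem e.2, ‖υ.grad e.2 x‖ ^ 2)) ≤
      2 * P / (2 * P + 1) * A := by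
    -- Positivity of λ* is available only if there is a face; otherwise the sum is empty.
    rcases 𝒯.faces.eq_empty_or_nonempty with h0 | ⟨e, he⟩
    · rw [h0, Finset.sum_empty, mul_zero]
      positivity
    · have hpos : 0 < lam := contrast_pos hm hδ hmδ α he
      have h1 := sum_faces_le_contrast_mul (s := s) hm hδ hmδ α hpos.le υ
      calc _ ≤ 2 * P / (2 * P + 1) / lam * (lam * A) := by gcongr
        _ = _ := by field_simp
  have hsemi : seminormSq 𝒯 η Λ m υ = A + B := by rw [seminormSq, hAnorm]
  have hlow : A + (1 / (2 * (P + 1) : ℝ) * B - 2 * P / (2 * P + 1) * A) ≤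
      form 𝒯 s η Λ m υ υ := by
    rw [form, hAform]
    linarith
  -- A fraction 1/(2P+1) of the energy survives, slightly more than the fraction 1/(2(P+1)) of the
  -- penalty; the smaller one determines C.
  have hcoef : (1 / (2 * (P + 1) : ℝ)) * A ≤ A - 2 * P / (2 * P + 1) * A := by
    have h1 : A - 2 * P / (2 * P + 1) * A = (1 / (2 * P + 1 : ℝ)) * A := by
      field_simp
      ring
    rw [h1]
    gcongr
    linarith
  have hfin : (1 / (2 * (P + 1) : ℝ)) * (A + B) ≤ form 𝒯 s η Λ m υ υ := by linarith
  rwa [hsemi, ← div_le_iff₀' (by positivity), div_eq_inv_mul, ← one_div]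

end coercivity

end DGMobility

theorem theorem2 (d : ℕ) (hd : 2 ≤ d) (pmax : ℕ) :
    ∃ C : ℝ, 0 < C ∧
      ∀ (N : ℕ) (𝒯 : DGMobility.Mesh d N) (s : DGMobility.Scheme)
        (p : Fin N → ℕ), (∀ i, 1 ≤ p i ∧ p i ≤ pmax) →
      ∀ (M : ℝ → ℝ), Continuous M →
      ∀ φ ∈ DGMobility.Broken.space (d := d) p,
      ∀ δ : ℝ, 0 < δ → (∀ i, ∀ x ∈ 𝒯.elem i, δ ≤ M (φ.val i x)) →
      ∀ α ∈ Set.Icc (0 : ℝ) (1 / 2),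
      ∀ (η : Fin N × Fin N → ℝ) (Λ : Fin N × Fin N → DGMobility.E d → ℝ),
        (∀ e ∈ 𝒯.faces, max ((p e.1 : ℝ) * (p e.1 + d - 1)) ((p e.2 : ℝ) * (p e.2 + d - 1)) ≤ η e) →
        (∀ e ∈ 𝒯.faces, MeasureTheory.IntegrableOn (Λ e) (𝒯.face e) (DGMobility.surf d)) →
        (∀ e ∈ 𝒯.faces, ∀ x ∈ 𝒯.face e,
          DGMobility.faceMob s (fun i y => M (φ.val i y)) e x ^ (2 * α) *
            DGMobility.contrast 𝒯 s α (fun i y => M (φ.val i y)) ≤ Λ e x) →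
      ∀ υ ∈ DGMobility.Broken.space (d := d) p,
        DGMobility.seminormSq 𝒯 η Λ (fun i y => M (φ.val i y)) υ ≤
          C * DGMobility.form 𝒯 s η Λ (fun i y => M (φ.val i y)) υ υ := by
  obtain ⟨k, rfl⟩ : ∃ k, d = k + 1 := ⟨d - 1, by omega⟩
  refine ⟨2 * (pmax + 1), by positivity, ?_⟩
  intro N 𝒯 s p hp M hM φ _ δ hδ hMδ α hα η Λ hη hΛ hΛle υ hυ
  exact DGMobility.seminormSq_le_form (fun i => hM.comp (φ.continuous_val i)) hδ hMδ (by omega) hp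
    hα.2 hη hΛ hΛle hυ
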